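/- Let $-2<a<2$. Consider the (normalized) McMillan sextupole map $$q'=p,\qquad p'=-q+f(p),\qquad f(p)=-\frac{p\,(p-a)}{p+1},$$ which preserves $H(q,p)=p^2q+pq^2+p^2-a\,p\,q+q^2$. Let $(q_0,p_0)$ lie on a closed invariant curve, i.e. the connected component through $(q_0,p_0)$ of the level set $\{H=h\}$, $h=H(q_0,p_0)$, is homeomorphic to a circle, and let $(q_n,p_n)_{n\ge 0}$ be its orbit. Then the quartic $$\mathcal P(x)=x^4-2(2+a)x^3+(a^2-4)x^2+4h\,x+4h$$ has four distinct real roots $r_1<r_2<r_3<r_4$, and $r_2\le q_n\le r_3$ for all $n$. Put $$\kappa=\sqrt{\frac{(r_3-r_2)(r_4-r_1)}{(r_3-r_1)(r_4-r_2)}},\qquad T'=\int_{r_2}^{f(r_2)/2}\frac{dx}{\sqrt{\mathcal P(x)}}$$ (the improper integral converges absolutely; $T'$ is the time of one step of the map), and let $\sigma=1$ if $p_0\ge f(q_0)/2$ and $\sigma=-1$ otherwise. Let $F[\varphi,\kappa]=\int_0^\varphi d\theta/\sqrt{1-\kappa^2\sin^2\theta}$ be the incomplete elliptic integral of the first kind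 and $\mathrm{sn}[u,\kappa]$ the Jacobi elliptic sine, both with modulus $\kappa$, so that $\mathrm{sn}[F[\varphi,\kappa],\kappa]=\sin\varphi$. Put $$t_1^*=-\,\frac{2\sigma}{\sqrt{(r_4-r_2)(r_3-r_1)}}\;F\!\left[\arcsin\sqrt{\frac{(r_3-r_1)(q_0-r_2)}{(r_3-r_2)(q_0-r_1)}},\kappa\right],$$ $$t_2^*=+\,\frac{2\sigma}{\sqrt{(r_4-r_2)(r_3-r_1)}}\;F\!\left[\arcsin\sqrt{\frac{(r_4-r_2)(q_0-r_3)}{(r_3-r_2)(q_0-r_4)}},\kappa\right],$$ and $\mathrm{sn}_i(t)=\mathrm{sn}\!\left[\sqrt{(r_4-r_2)(r_3-r_1)}\,\frac{t-t_i^*}{2},\kappa\right]$ for $i=1,2$. Then for all $t\in\mathbb R$ the two expressions $$q(t)=\frac{r_2-r_1\frac{r_3-r_2}{r_3-r_1}\,\mathrm{sn}_1^2(t)}{1-\frac{r_3-r_2}{r_3-r_1}\,\mathrm{sn}_1^2(t)}=\frac{r_3-r_4\frac{r_3-r_2}{r_4-r_2}\,\mathrm{sn}_2^2(t)}{1-\frac{r_3-r_2}{r_4-r_2}\,\mathrm{sn}_2^2(t)}$$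 agree; $q(t)$ is the coordinate of the solution of Hamilton's equations $\dot q=\partial H/\partial p$, $\dot p=-\partial H/\partial q$ with $(q(0),p(0))=(q_0,p_0)$; and the orbit of the map is given by $$q_n=q(nT'),\qquad p_n=q((n+1)T')\qquad(n\ge 0).$$ -/

import Mathlib

namespace McMillan

noncomputable section

/-! ### The McMillan sextupole -/

/-- The force function of the (normalized) McMillan sextupole. -/
def force (a p : ℝ) : ℝ := -(p * (p - a) / (p + 1))

/-- One step `(q, p) ↦ (p, -q + f(p))` of the McMillan sextupole map. -/
def sextupoleMap (a : ℝ) (z : ℝ × ℝ) : ℝ × ℝ := (z.2, -z.1 + force a z.2)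

/-- The integral of motion `p² q + p q² + p² - a p q + q²` at `z = (q, p)`. -/
def invariant (a : ℝ) (z : ℝ × ℝ) : ℝ :=
  z.2 ^ 2 * z.1 + z.2 * z.1 ^ 2 + z.2 ^ 2 - a * z.2 * z.1 + z.1 ^ 2

/-- The point `z` lies on a closed invariant curve: the connected component through `z` of the
level set of the integral of motion is a (topological) circle. -/
def OnClosedInvariantCurve (a : ℝ) (z : ℝ × ℝ) : Prop :=
  Nonempty (connectedComponentIn {w : ℝ × ℝ | invariant a w = invariant a z} z ≃ₜ Circle)

/-- `t ↦ (q t, p t)` solves Hamilton's equations `q̇ = ∂H/∂p`, `ṗ = -∂H/∂q` for the Hamiltonian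
`H = invariant a`. -/
def SolvesHamilton (a : ℝ) (q p : ℝ → ℝ) : Prop :=
  ∀ t : ℝ,
    HasDerivAt q (q t ^ 2 - a * q t + 2 * p t + 2 * p t * q t) t ∧
    HasDerivAt p (-(p t ^ 2 - a * p t + 2 * q t + 2 * p t * q t)) t

/-- The characteristic polynomial of the level `H = h`; on this level
`2 (q + 1) p = (q + 1) f(q) ± √(charPoly a h q)`. -/
def charPoly (a h x : ℝ) : ℝ :=
  x ^ 4 - 2 * (2 + a) * x ^ 3 + (a ^ 2 - 4) * x ^ 2 + 4 * h * x + 4 * h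

/-- The time `T' = ∫ dq / √(charPoly)` of one step of the map on the level `H = h`, the integral
being taken from the turning point `r₂` to its image, whose coordinate is `f(r₂) / 2`. -/
def stepTime (a h r₂ : ℝ) : ℝ :=
  ∫ x in r₂..(force a r₂ / 2), 1 / √(charPoly a h x)

/-! ### Elliptic integrals and the Jacobi elliptic sine, as functions of the modulus -/

/-- The incomplete elliptic integral of the first kind `F[φ, k]`, with modulus `k`. -/
def ellipticF (φ k : ℝ) : ℝ := ∫ θ in (0 : ℝ)..φ, 1 / √(1 - k ^ 2 * Real.sin θ ^ 2)

/-- The Jacobi amplitude: the inverse function of `φ ↦ F[φ, k]`. -/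
def jacobiAm (u k : ℝ) : ℝ := Function.invFun (fun φ => ellipticF φ k) u

/-- The Jacobi elliptic sine `sn[u, k]`. -/
def jacobiSn (u k : ℝ) : ℝ := Real.sin (jacobiAm u k)

section Amplitude

theorem one_sub_pos {k : ℝ} (hk : |k| < 1) (θ : ℝ) : 0 < 1 - k ^ 2 * Real.sin θ ^ 2 := by
  have h1 : k ^ 2 < 1 := (sq_lt_one_iff_abs_lt_one k).2 hk
  have h2 : Real.sin θ ^ 2 ≤ 1 := Real.sin_sq_le_one θ
  nlinarith [sq_nonneg k, sq_nonneg (Real.sin θ)]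

theorem continuous_ellipticIntegrand {k : ℝ} (hk : |k| < 1) :
    Continuous fun θ : ℝ => 1 / √(1 - k ^ 2 * Real.sin θ ^ 2) :=
  continuous_const.div (by fun_prop) fun θ => (Real.sqrt_pos.2 (one_sub_pos hk θ)).ne'

theorem hasDerivAt_ellipticF {k : ℝ} (hk : |k| < 1) (φ : ℝ) :
    HasDerivAt (fun φ => ellipticF φ k) (1 / √(1 - k ^ 2 * Real.sin φ ^ 2)) φ :=
  intervalIntegral.integral_hasDerivAt_right
    ((continuous_ellipticIntegrand hk).intervalIntegrable _ _)
    ((continuous_ellipticIntegrand hk).stronglyMeasurableAtFilter _ _)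
    (continuous_ellipticIntegrand hk).continuousAt

/-- The elliptic integral grows at least as fast as its upper limit. -/
theorem sub_le_ellipticF_sub {k : ℝ} (hk : |k| < 1) {x y : ℝ} (hxy : x ≤ y) :
    y - x ≤ ellipticF y k - ellipticF x k := by
  have hm : Monotone fun φ => ellipticF φ k - φ := by
    have hd : ∀ φ, HasDerivAt (fun φ => ellipticF φ k - φ)
        (1 / √(1 - k ^ 2 * Real.sin φ ^ 2) - 1) φ :=
      fun φ => (hasDerivAt_ellipticF hk φ).sub (hasDerivAt_id φ)
    refine monotone_of_deriv_nonneg (fun φ => (hd φ).differentiableAt) fun φ => ?_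
    rw [(hd φ).deriv, sub_nonneg]
    refine (one_le_div (Real.sqrt_pos.2 (one_sub_pos hk φ))).2 (Real.sqrt_le_one.2 ?_)
    nlinarith [mul_nonneg (sq_nonneg k) (sq_nonneg (Real.sin φ))]
  have := hm hxy
  simp only at this
  linarith

/-- For a modulus in `(-1, 1)` the inverse function defining the amplitude is a genuine one. -/
theorem ellipticF_bijective {k : ℝ} (hk : |k| < 1) :
    Function.Bijective fun φ => ellipticF φ k := by
  have h0 : ellipticF 0 k = 0 := by simp [ellipticF]
  have hc : Continuous fun φ => ellipticF φ k :=
    continuous_iff_continuousAt.2 fun φ => (hasDerivAt_ellipticF hk φ).continuousAt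
  constructor
  · refine StrictMono.injective fun x y hxy => ?_
    have := sub_le_ellipticF_sub hk hxy.le
    linarith
  · refine hc.surjective ?_ ?_
    · refine Filter.tendsto_atTop_mono' _ ?_ Filter.tendsto_id
      filter_upwards [Filter.eventually_ge_atTop (0 : ℝ)] with x hx
      have := sub_le_ellipticF_sub hk hx
      simp only [id]
      linarith
    · refine Filter.tendsto_atBot_mono' _ ?_ Filter.tendsto_id
      filter_upwards [Filter.eventually_le_atBot (0 : ℝ)] with x hx
      have := sub_le_ellipticF_sub hk hx
      simp only [id]
      linarith

/-- The defining property of the Jacobi sine. -/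
theorem jacobiSn_ellipticF {k : ℝ} (hk : |k| < 1) (φ : ℝ) :
    jacobiSn (ellipticF φ k) k = Real.sin φ := by
  have := Function.leftInverse_invFun (ellipticF_bijective hk).1 φ
  rw [jacobiSn, jacobiAm, this]

end Amplitude

/-! ### The parametrization

Here `r₁ < r₂ < r₃ < r₄` are the roots of the characteristic polynomial, `q₀` is the initial
coordinate and `σ` is the sign of the initial velocity `dq/dt`. -/

/-- The elliptic modulus. -/
def modulus (r₁ r₂ r₃ r₄ : ℝ) : ℝ :=
  √(((r₃ - r₂) * (r₄ - r₁)) / ((r₃ - r₁) * (r₄ - r₂)))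

/-- The sign of `dq/dt` at `z = (q, p)`: the branch of the level set on which `z` lies, `1` if
`p ≥ f(q) / 2` and `-1` otherwise. -/
def branchSign (a : ℝ) (z : ℝ × ℝ) : ℝ := if force a z.1 / 2 ≤ z.2 then 1 else -1

/-- The first initial phase shift. -/
def phaseShift₁ (σ q₀ r₁ r₂ r₃ r₄ : ℝ) : ℝ :=
  -σ * (2 * ellipticF
    (Real.arcsin (√(((r₃ - r₁) * (q₀ - r₂)) / ((r₃ - r₂) * (q₀ - r₁)))))
    (modulus r₁ r₂ r₃ r₄) / √((r₄ - r₂) * (r₃ - r₁)))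

/-- The second initial phase shift. -/
def phaseShift₂ (σ q₀ r₁ r₂ r₃ r₄ : ℝ) : ℝ :=
  σ * (2 * ellipticF
    (Real.arcsin (√(((r₄ - r₂) * (q₀ - r₃)) / ((r₃ - r₂) * (q₀ - r₄)))))
    (modulus r₁ r₂ r₃ r₄) / √((r₄ - r₂) * (r₃ - r₁)))

/-- The elliptic sine with phase shift `s`, evaluated at time `t`. -/
def shiftedSn (s r₁ r₂ r₃ r₄ t : ℝ) : ℝ :=
  jacobiSn (√((r₄ - r₂) * (r₃ - r₁)) * ((t - s) / 2)) (modulus r₁ r₂ r₃ r₄)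

/-- The first form of the parametrization `q(t)`. -/
def param₁ (σ q₀ r₁ r₂ r₃ r₄ t : ℝ) : ℝ :=
  (r₂ - r₁ * ((r₃ - r₂) / (r₃ - r₁)) *
      shiftedSn (phaseShift₁ σ q₀ r₁ r₂ r₃ r₄) r₁ r₂ r₃ r₄ t ^ 2) /
    (1 - (r₃ - r₂) / (r₃ - r₁) *
      shiftedSn (phaseShift₁ σ q₀ r₁ r₂ r₃ r₄) r₁ r₂ r₃ r₄ t ^ 2)

/-- The second form of the parametrization `q(t)`. -/
def param₂ (σ q₀ r₁ r₂ r₃ r₄ t : ℝ) : ℝ :=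
  (r₃ - r₄ * ((r₃ - r₂) / (r₄ - r₂)) *
      shiftedSn (phaseShift₂ σ q₀ r₁ r₂ r₃ r₄) r₁ r₂ r₃ r₄ t ^ 2) /
    (1 - (r₃ - r₂) / (r₄ - r₂) *
      shiftedSn (phaseShift₂ σ q₀ r₁ r₂ r₃ r₄) r₁ r₂ r₃ r₄ t ^ 2)

end

end McMillan

namespace McMillan

noncomputable section

/-! ### The Jacobi amplitude -/

/-! Seen as a quadratic in `p`, the equation `H = h` has discriminant `charPoly a h q`, and `∂H/∂p =
2 (q + 1) p + q² - a q` is a square root of it. Hence `q̇² = P(q)` along the Hamiltonian flow, and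
since `H` is symmetric also `ṗ² = P(p)`. Both coordinates therefore solve the second-order equation
`ẍ = P'(x) / 2` between the same two roots, so each is a time translate of a single oscillation,
`wave`. The second-order form is needed because `ẋ² = P(x)` alone loses uniqueness at turning
points; `oscillation_unique` supplies uniqueness.

When `q` is at `r₂` its velocity is zero and `p` is at `f(r₂) / 2`, moving upwards. So `p(t) = q(t +
T')`, where `T'` is the travel time from `r₂` to `f(r₂) / 2` (`momentum_wave`,
`integral_inv_sqrt_quartic`). Reversing time exchanges the two roots `p` over the same `q`, whose
sum is `f(q)`; this gives `q(t + T') + q(t - T') = f(q(t))` (`wave_add_wave`), which is the map. The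
second closed form is the same oscillation built from the roots in reverse order, which is why
`IsChain` admits both orders.

The roots come from topology. A closed component contains a whole branch over any interval with `P ≥
0` that it meets and that avoids `-1` (`IsClosedComponent.exists_graph_subset`). Compactness then
forces `P` to become negative on both sides of the component, before infinity and before the pole `q
= -1`, and the resulting sign changes yield four roots with `-1 < r₂`. -/

theorem jacobiAm_ellipticF {k : ℝ} (hk : |k| < 1) (φ : ℝ) : jacobiAm (ellipticF φ k) k = φ :=
  Function.leftInverse_invFun (ellipticF_bijective hk).1 φ

theorem ellipticF_jacobiAm {k : ℝ} (hk : |k| < 1) (u : ℝ) : ellipticF (jacobiAm u k) k = u :=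
  Function.rightInverse_invFun (ellipticF_bijective hk).2 u

theorem ellipticF_zero (k : ℝ) : ellipticF 0 k = 0 := by simp [ellipticF]

theorem ellipticF_neg (φ k : ℝ) : ellipticF (-φ) k = -ellipticF φ k := by
  have h := intervalIntegral.integral_comp_neg (a := 0) (b := φ)
    fun θ : ℝ => 1 / √(1 - k ^ 2 * Real.sin θ ^ 2)
  simp only [Real.sin_neg, neg_sq, neg_zero] at h
  rw [ellipticF, ellipticF, h, intervalIntegral.integral_symm]

theorem jacobiAm_zero {k : ℝ} (hk : |k| < 1) : jacobiAm 0 k = 0 := by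
  simpa [ellipticF_zero] using jacobiAm_ellipticF hk 0

theorem jacobiAm_neg {k : ℝ} (hk : |k| < 1) (u : ℝ) : jacobiAm (-u) k = -jacobiAm u k := by
  rw [← jacobiAm_ellipticF hk (-jacobiAm u k), ellipticF_neg, ellipticF_jacobiAm hk]

theorem strictMono_jacobiAm {k : ℝ} (hk : |k| < 1) : StrictMono fun u => jacobiAm u k := by
  intro u v huv
  by_contra h
  have := sub_le_ellipticF_sub hk (not_lt.1 h)
  simp only [ellipticF_jacobiAm hk] at this h
  linarith

/-- The elliptic integral expands distances, so its inverse contracts them. The resulting continuity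
is what the inverse function rule for the derivative requires. -/
theorem abs_jacobiAm_sub_le {k : ℝ} (hk : |k| < 1) (u v : ℝ) :
    |jacobiAm u k - jacobiAm v k| ≤ |u - v| := by
  have hm := (strictMono_jacobiAm hk).monotone
  rcases le_total u v with h | h
  · have h1 := hm h
    have := sub_le_ellipticF_sub hk h1
    simp only [ellipticF_jacobiAm hk] at this h1
    rw [abs_of_nonpos (by linarith), abs_of_nonpos (by linarith)]
    linarith
  · have h1 := hm h
    have := sub_le_ellipticF_sub hk h1
    simp only [ellipticF_jacobiAm hk] at this h1
    rw [abs_of_nonneg (by linarith), abs_of_nonneg (by linarith)]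
    linarith

theorem continuous_jacobiAm {k : ℝ} (hk : |k| < 1) : Continuous fun u => jacobiAm u k :=
  (LipschitzWith.of_dist_le_mul (K := 1) fun u v => by
    simpa [Real.dist_eq] using abs_jacobiAm_sub_le hk u v).continuous

theorem hasDerivAt_jacobiAm {k : ℝ} (hk : |k| < 1) (u : ℝ) :
    HasDerivAt (fun u => jacobiAm u k) (√(1 - k ^ 2 * Real.sin (jacobiAm u k) ^ 2)) u := by
  have hpos := Real.sqrt_pos.2 (one_sub_pos hk (jacobiAm u k))
  have := HasDerivAt.of_local_left_inverse (continuous_jacobiAm hk).continuousAt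
    (hasDerivAt_ellipticF hk (jacobiAm u k)) (by positivity)
    (Filter.Eventually.of_forall fun y => ellipticF_jacobiAm hk y)
  simpa using this

/-! ### The oscillation between two adjacent roots of a quartic -/

/-- The monic quartic with the given roots. -/
def quartic (r₁ r₂ r₃ r₄ x : ℝ) : ℝ := (x - r₁) * (x - r₂) * (x - r₃) * (x - r₄)

/-- The derivative of `quartic`. -/
def quarticDeriv (r₁ r₂ r₃ r₄ x : ℝ) : ℝ :=
  (x - r₂) * (x - r₃) * (x - r₄) + (x - r₁) * (x - r₃) * (x - r₄) +
    (x - r₁) * (x - r₂) * (x - r₄) + (x - r₁) * (x - r₂) * (x - r₃)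

theorem hasDerivAt_quartic (r₁ r₂ r₃ r₄ x : ℝ) :
    HasDerivAt (quartic r₁ r₂ r₃ r₄) (quarticDeriv r₁ r₂ r₃ r₄ x) x := by
  have h (r : ℝ) : HasDerivAt (fun x => x - r) 1 x := (hasDerivAt_id x).sub_const r
  refine ((((h r₁).mul (h r₂)).mul (h r₃)).mul (h r₄)).congr_deriv ?_
  simp only [quarticDeriv, Pi.mul_apply]
  ring

/-- Four real numbers in increasing or in decreasing order. -/
def IsChain (r₁ r₂ r₃ r₄ : ℝ) : Prop :=
  (r₁ < r₂ ∧ r₂ < r₃ ∧ r₃ < r₄) ∨ (r₄ < r₃ ∧ r₃ < r₂ ∧ r₂ < r₁)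

/-- The angular frequency of the amplitude. -/
def frequency (r₁ r₂ r₃ r₄ : ℝ) : ℝ := √((r₄ - r₂) * (r₃ - r₁))

/-- The coefficient of `sn²` in the denominator of the oscillation. -/
def ratio (r₁ r₂ r₃ : ℝ) : ℝ := (r₃ - r₂) / (r₃ - r₁)

/-- The amplitude at time `t` of the oscillation. -/
def amplitude (r₁ r₂ r₃ r₄ t : ℝ) : ℝ :=
  jacobiAm (frequency r₁ r₂ r₃ r₄ * (t / 2)) (modulus r₁ r₂ r₃ r₄)

/-- The oscillation between `r₂` and `r₃` that starts at `r₂`, as a function of the amplitude. -/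
def profile (r₁ r₂ r₃ θ : ℝ) : ℝ :=
  (r₂ - r₁ * ratio r₁ r₂ r₃ * Real.sin θ ^ 2) / (1 - ratio r₁ r₂ r₃ * Real.sin θ ^ 2)

/-- The velocity of the oscillation, as a function of the amplitude. -/
def profileVel (r₁ r₂ r₃ r₄ θ : ℝ) : ℝ :=
  (r₂ - r₁) * ratio r₁ r₂ r₃ * frequency r₁ r₂ r₃ r₄ * (Real.sin θ * Real.cos θ *
    √(1 - modulus r₁ r₂ r₃ r₄ ^ 2 * Real.sin θ ^ 2)) / (1 - ratio r₁ r₂ r₃ * Real.sin θ ^ 2) ^ 2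

/-- The oscillation between `r₂` and `r₃` that starts at `r₂`. -/
def wave (r₁ r₂ r₃ r₄ t : ℝ) : ℝ := profile r₁ r₂ r₃ (amplitude r₁ r₂ r₃ r₄ t)

/-- The velocity of the oscillation. -/
def waveVel (r₁ r₂ r₃ r₄ t : ℝ) : ℝ := profileVel r₁ r₂ r₃ r₄ (amplitude r₁ r₂ r₃ r₄ t)

/-- The first nonnegative time at which the oscillation is at `x`. -/
def crossTime (r₁ r₂ r₃ r₄ x : ℝ) : ℝ :=
  2 * ellipticF (Real.arcsin (√(((r₃ - r₁) * (x - r₂)) / ((r₃ - r₂) * (x - r₁)))))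
    (modulus r₁ r₂ r₃ r₄) / frequency r₁ r₂ r₃ r₄

section

variable {r₁ r₂ r₃ r₄ : ℝ}

/-- Each product has two factors that change sign together when the order is reversed, so its sign
is the same for increasing and decreasing chains. -/
theorem IsChain.mul_pos (h : IsChain r₁ r₂ r₃ r₄) :
    0 < (r₂ - r₁) * (r₃ - r₂) ∧ 0 < (r₃ - r₂) * (r₄ - r₃) ∧ 0 < (r₃ - r₂) * (r₃ - r₁) ∧
    0 < (r₂ - r₁) * (r₃ - r₁) ∧ 0 < (r₄ - r₂) * (r₃ - r₁) ∧ 0 < (r₃ - r₂) * (r₄ - r₁) ∧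
    0 < (r₂ - r₁) * (r₄ - r₃) ∧ 0 < (r₂ - r₁) * (r₄ - r₂) := by
  rcases h with ⟨h1, h2, h3⟩ | ⟨h1, h2, h3⟩
  · refine ⟨?_, ?_, ?_, ?_, ?_, ?_, ?_, ?_⟩ <;> apply _root_.mul_pos <;> linarith
  · refine ⟨?_, ?_, ?_, ?_, ?_, ?_, ?_, ?_⟩ <;> apply mul_pos_of_neg_of_neg <;> linarith

theorem IsChain.ne (h : IsChain r₁ r₂ r₃ r₄) :
    r₂ - r₁ ≠ 0 ∧ r₃ - r₂ ≠ 0 ∧ r₃ - r₁ ≠ 0 ∧ r₄ - r₂ ≠ 0 := by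
  obtain ⟨h1, -, h3, -, h5, -⟩ := h.mul_pos
  exact ⟨left_ne_zero_of_mul h1.ne', right_ne_zero_of_mul h1.ne', right_ne_zero_of_mul h3.ne',
    left_ne_zero_of_mul h5.ne'⟩

theorem IsChain.frequency_pos (h : IsChain r₁ r₂ r₃ r₄) : 0 < frequency r₁ r₂ r₃ r₄ :=
  Real.sqrt_pos.2 h.mul_pos.2.2.2.2.1

theorem IsChain.frequency_sq (h : IsChain r₁ r₂ r₃ r₄) :
    frequency r₁ r₂ r₃ r₄ ^ 2 = (r₄ - r₂) * (r₃ - r₁) :=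
  Real.sq_sqrt h.mul_pos.2.2.2.2.1.le

theorem IsChain.modulus_sq (h : IsChain r₁ r₂ r₃ r₄) :
    modulus r₁ r₂ r₃ r₄ ^ 2 = ((r₃ - r₂) * (r₄ - r₁)) / ((r₃ - r₁) * (r₄ - r₂)) := by
  obtain ⟨-, -, -, -, h5, h6, -⟩ := h.mul_pos
  exact Real.sq_sqrt (div_nonneg h6.le (by linarith))

/-- Denominator minus numerator of the squared modulus is `(r₂ - r₁) * (r₄ - r₃)`. -/
theorem IsChain.abs_modulus_lt (h : IsChain r₁ r₂ r₃ r₄) : |modulus r₁ r₂ r₃ r₄| < 1 := by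
  rw [← sq_lt_one_iff_abs_lt_one, h.modulus_sq]
  obtain ⟨-, -, -, -, h5, h6, h7, -⟩ := h.mul_pos
  rw [div_lt_one (by linarith)]
  linarith

theorem IsChain.ratio_pos (h : IsChain r₁ r₂ r₃ r₄) : 0 < ratio r₁ r₂ r₃ := by
  have := h.mul_pos.2.2.1
  rw [ratio, ← mul_div_mul_right _ _ h.ne.2.2.1]
  exact div_pos this (mul_self_pos.2 h.ne.2.2.1)

theorem IsChain.ratio_lt (h : IsChain r₁ r₂ r₃ r₄) : ratio r₁ r₂ r₃ < 1 := by
  have := h.mul_pos.2.2.2.1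
  have h3 := h.ne.2.2.1
  rw [ratio, ← mul_div_mul_right _ _ h3, div_lt_one (mul_self_pos.2 h3)]
  linarith

theorem IsChain.denom_pos (h : IsChain r₁ r₂ r₃ r₄) (θ : ℝ) :
    0 < 1 - ratio r₁ r₂ r₃ * Real.sin θ ^ 2 := by
  have := h.ratio_pos
  have := h.ratio_lt
  nlinarith [Real.sin_sq_le_one θ, sq_nonneg (Real.sin θ)]

/-- Over the common denominator the four differences are proportional to `1`, `sin²`, `cos²` and `1
- k² sin²`. Their product is then visibly a square, which gives the energy relation `profileVel_sq`;
the modulus is chosen to make the last one come out. -/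
theorem IsChain.profile_sub (h : IsChain r₁ r₂ r₃ r₄) (θ : ℝ) :
    profile r₁ r₂ r₃ θ - r₁ = (r₂ - r₁) / (1 - ratio r₁ r₂ r₃ * Real.sin θ ^ 2) ∧
    profile r₁ r₂ r₃ θ - r₂ = (r₂ - r₁) * ratio r₁ r₂ r₃ * Real.sin θ ^ 2 /
      (1 - ratio r₁ r₂ r₃ * Real.sin θ ^ 2) ∧
    profile r₁ r₂ r₃ θ - r₃ = -((r₃ - r₂) * (1 - Real.sin θ ^ 2) /
      (1 - ratio r₁ r₂ r₃ * Real.sin θ ^ 2)) ∧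
    profile r₁ r₂ r₃ θ - r₄ = -((r₄ - r₂) * (1 - modulus r₁ r₂ r₃ r₄ ^ 2 * Real.sin θ ^ 2) /
      (1 - ratio r₁ r₂ r₃ * Real.sin θ ^ 2)) := by
  have hd := (h.denom_pos θ).ne'
  obtain ⟨-, -, h3, h4⟩ := h.ne
  rw [h.modulus_sq, profile]
  have hr : ratio r₁ r₂ r₃ * (r₃ - r₁) = r₃ - r₂ := div_mul_cancel₀ _ h3
  refine ⟨?_, ?_, ?_, ?_⟩
  · field_simp; ring
  · field_simp; ring
  · field_simp
    linear_combination (Real.sin θ ^ 2) * hr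
  · have : (r₃ - r₂) * (r₄ - r₁) / ((r₃ - r₁) * (r₄ - r₂)) * (r₄ - r₂) =
        ratio r₁ r₂ r₃ * (r₄ - r₁) := by
      rw [ratio]; field_simp
    rw [eq_comm, ← sub_eq_zero]
    have h' : (r₄ - r₂) * (1 - (r₃ - r₂) * (r₄ - r₁) / ((r₃ - r₁) * (r₄ - r₂)) *
        Real.sin θ ^ 2) = (r₄ - r₂) - ratio r₁ r₂ r₃ * (r₄ - r₁) * Real.sin θ ^ 2 := by
      rw [← this]; ring
    rw [h']
    field_simp
    ring

theorem IsChain.profileVel_sq (h : IsChain r₁ r₂ r₃ r₄) (θ : ℝ) :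
    profileVel r₁ r₂ r₃ r₄ θ ^ 2 = quartic r₁ r₂ r₃ r₄ (profile r₁ r₂ r₃ θ) := by
  have hd := (h.denom_pos θ).ne'
  obtain ⟨e1, e2, e3, e4⟩ := h.profile_sub θ
  have hΔ := Real.sq_sqrt (one_sub_pos h.abs_modulus_lt θ).le
  have hr : ratio r₁ r₂ r₃ * (r₃ - r₁) = r₃ - r₂ := div_mul_cancel₀ _ h.ne.2.2.1
  rw [quartic, e1, e2, e3, e4, profileVel, div_pow]
  simp only [mul_pow]
  rw [hΔ, h.frequency_sq, Real.cos_sq', ← hr]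
  field_simp

theorem IsChain.hasDerivAt_amplitude (h : IsChain r₁ r₂ r₃ r₄) (t : ℝ) :
    HasDerivAt (amplitude r₁ r₂ r₃ r₄)
      (√(1 - modulus r₁ r₂ r₃ r₄ ^ 2 * Real.sin (amplitude r₁ r₂ r₃ r₄ t) ^ 2) *
        (frequency r₁ r₂ r₃ r₄ / 2)) t := by
  have h1 : HasDerivAt (fun t : ℝ => frequency r₁ r₂ r₃ r₄ * (t / 2))
      (frequency r₁ r₂ r₃ r₄ / 2) t :=
    (((hasDerivAt_id t).div_const 2).const_mul _).congr_deriv (by ring)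
  exact (hasDerivAt_jacobiAm h.abs_modulus_lt _).comp t h1

theorem IsChain.hasDerivAt_wave (h : IsChain r₁ r₂ r₃ r₄) (t : ℝ) :
    HasDerivAt (wave r₁ r₂ r₃ r₄) (waveVel r₁ r₂ r₃ r₄ t) t := by
  have hθ := h.hasDerivAt_amplitude t
  have hd := (h.denom_pos (amplitude r₁ r₂ r₃ r₄ t)).ne'
  have hs := (hθ.sin.pow 2)
  refine (((hs.const_mul (r₁ * ratio r₁ r₂ r₃)).const_sub r₂).div
    ((hs.const_mul (ratio r₁ r₂ r₃)).const_sub 1) hd).congr_deriv ?_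
  rw [waveVel, profileVel]
  simp only [Pi.pow_apply]
  congr 1
  push_cast
  ring

/-- This is `ẍ = P'(x) / 2`, checked by direct differentiation so that it holds at the turning
points too, where it cannot be obtained by dividing the differentiated energy relation by the
velocity. -/
theorem IsChain.hasDerivAt_waveVel (h : IsChain r₁ r₂ r₃ r₄) (t : ℝ) :
    HasDerivAt (waveVel r₁ r₂ r₃ r₄) (quarticDeriv r₁ r₂ r₃ r₄ (wave r₁ r₂ r₃ r₄ t) / 2) t := by
  have hθ := h.hasDerivAt_amplitude t
  obtain ⟨e1, e2, e3, e4⟩ := h.profile_sub (amplitude r₁ r₂ r₃ r₄ t)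
  have hd := (h.denom_pos (amplitude r₁ r₂ r₃ r₄ t)).ne'
  have hp := one_sub_pos h.abs_modulus_lt (amplitude r₁ r₂ r₃ r₄ t)
  have hs := (hθ.sin.pow 2)
  have hΔ := (((hs.const_mul (modulus r₁ r₂ r₃ r₄ ^ 2)).const_sub 1).sqrt hp.ne')
  refine ((((hθ.sin.mul hθ.cos).mul hΔ).const_mul
    ((r₂ - r₁) * ratio r₁ r₂ r₃ * frequency r₁ r₂ r₃ r₄)).div
    (((hs.const_mul (ratio r₁ r₂ r₃)).const_sub 1).pow 2) (pow_ne_zero 2 hd)).congr_deriv ?_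
  rw [quarticDeriv, wave, e1, e2, e3, e4]
  simp only [Pi.pow_apply, Pi.mul_apply]
  have hr : ratio r₁ r₂ r₃ * (r₃ - r₁) = r₃ - r₂ := div_mul_cancel₀ _ h.ne.2.2.1
  have hw := h.frequency_sq
  have hm : modulus r₁ r₂ r₃ r₄ ^ 2 * (r₄ - r₂) = ratio r₁ r₂ r₃ * (r₄ - r₁) := by
    obtain ⟨-, -, h3, h4⟩ := h.ne
    rw [h.modulus_sq, ratio]; field_simp
  have hq := Real.sq_sqrt hp.le
  have hq' := Real.sqrt_pos.2 hp
  have hc := Real.cos_sq' (amplitude r₁ r₂ r₃ r₄ t)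
  have h3 := h.ne.2.2.1
  have h4 := h.ne.2.2.2
  generalize √(1 - modulus r₁ r₂ r₃ r₄ ^ 2 * Real.sin (amplitude r₁ r₂ r₃ r₄ t) ^ 2) = Δ at *
  generalize Real.sin (amplitude r₁ r₂ r₃ r₄ t) = s at *
  generalize Real.cos (amplitude r₁ r₂ r₃ r₄ t) = c at *
  generalize frequency r₁ r₂ r₃ r₄ = w at *
  generalize modulus r₁ r₂ r₃ r₄ = m at *
  generalize ratio r₁ r₂ r₃ = k at *
  generalize hD : 1 - k * s ^ 2 = D at *
  -- All root differences are expressed through `r₃ - r₁`, `r₄ - r₂` and the ratio `k`; what remains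
  -- is a rational identity in these and `s²`.
  have e2 : r₂ - r₁ = (r₃ - r₁) * (1 - k) := by linear_combination hr
  have e4 : r₄ - r₁ = (r₄ - r₂) + (r₃ - r₁) * (1 - k) := by linear_combination e2
  have hw' : w * w = (r₄ - r₂) * (r₃ - r₁) := by rw [← hw, sq]
  rw [← hr, e2]
  rw [e4] at hm
  generalize r₃ - r₁ = e at *
  generalize r₄ - r₂ = d at *
  have hL : e * (1 - k) * k * (d * e) / 2 *
      (((c ^ 2 - s ^ 2) * Δ ^ 2 - m ^ 2 * s ^ 2 * c ^ 2) * D + 4 * k * s ^ 2 * c ^ 2 * Δ ^ 2) /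
      D ^ 3 = (-(k * e * (1 - s ^ 2) / D) * -(d * (1 - m ^ 2 * s ^ 2) / D) *
      (e * (1 - k) * k * s ^ 2 / D + e * (1 - k) / D) +
      (e * (1 - k) * k * s ^ 2 / D) * (e * (1 - k) / D) *
      (-(k * e * (1 - s ^ 2) / D) + -(d * (1 - m ^ 2 * s ^ 2) / D))) / 2 := by
    have h1 : d * (1 - m ^ 2 * s ^ 2) = d - k * (d + e * (1 - k)) * s ^ 2 := by
      linear_combination -s ^ 2 * hm
    rw [h1]
    rw [div_eq_iff (pow_ne_zero 3 hd)]
    -- The factor `d` is kept attached because the squared modulus can be eliminated polynomially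
    -- only in the combination `m ^ 2 * d`.
    have h2 : d * (((c ^ 2 - s ^ 2) * Δ ^ 2 - m ^ 2 * s ^ 2 * c ^ 2) * D +
        4 * k * s ^ 2 * c ^ 2 * Δ ^ 2) =
        ((c ^ 2 - s ^ 2) * (d - k * (d + e * (1 - k)) * s ^ 2) -
          k * (d + e * (1 - k)) * s ^ 2 * c ^ 2) * D +
        4 * k * s ^ 2 * c ^ 2 * (d - k * (d + e * (1 - k)) * s ^ 2) := by
      rw [hq, ← hm]; ring
    rw [show ∀ X, e * (1 - k) * k * (d * e) / 2 * X = e * (1 - k) * k * e / 2 * (d * X) by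
      intro X; ring, h2, hc]
    field_simp
    rw [← hD]
    ring
  calc _ = e * (1 - k) * k * (d * e) / 2 *
      (((c ^ 2 - s ^ 2) * Δ ^ 2 - m ^ 2 * s ^ 2 * c ^ 2) * D + 4 * k * s ^ 2 * c ^ 2 * Δ ^ 2) /
      D ^ 3 := by
        rw [← hw']
        push_cast
        field_simp
        ring
    _ = _ := by rw [hL]; ring

/-! #### Range, parity and inversion -/

theorem IsChain.wave_mem (h : IsChain r₁ r₂ r₃ r₄) (t : ℝ) :
    (wave r₁ r₂ r₃ r₄ t - r₂) * (wave r₁ r₂ r₃ r₄ t - r₃) ≤ 0 := by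
  obtain ⟨-, e2, e3, -⟩ := h.profile_sub (amplitude r₁ r₂ r₃ r₄ t)
  rw [wave, e2, e3, mul_neg, neg_nonpos, div_mul_div_comm]
  have h1 := h.mul_pos.1
  have h2 := h.ratio_pos
  have h3 := Real.sin_sq_le_one (amplitude r₁ r₂ r₃ r₄ t)
  have h4 := h.denom_pos (amplitude r₁ r₂ r₃ r₄ t)
  refine div_nonneg ?_ (_root_.mul_pos h4 h4).le
  rw [show ∀ x y z w v : ℝ, x * y * z * (w * v) = (x * w) * y * z * v by intros; ring]
  exact mul_nonneg (by positivity) (by linarith)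

theorem IsChain.amplitude_neg (h : IsChain r₁ r₂ r₃ r₄) (t : ℝ) :
    amplitude r₁ r₂ r₃ r₄ (-t) = -amplitude r₁ r₂ r₃ r₄ t := by
  rw [amplitude, amplitude, ← jacobiAm_neg h.abs_modulus_lt]
  congr 1
  ring

theorem IsChain.amplitude_zero (h : IsChain r₁ r₂ r₃ r₄) : amplitude r₁ r₂ r₃ r₄ 0 = 0 := by
  simp [amplitude, jacobiAm_zero h.abs_modulus_lt]

theorem IsChain.strictMono_amplitude (h : IsChain r₁ r₂ r₃ r₄) :
    StrictMono (amplitude r₁ r₂ r₃ r₄) := fun x y hxy =>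
  strictMono_jacobiAm h.abs_modulus_lt (mul_lt_mul_of_pos_left (by linarith) h.frequency_pos)

theorem IsChain.wave_neg (h : IsChain r₁ r₂ r₃ r₄) (t : ℝ) :
    wave r₁ r₂ r₃ r₄ (-t) = wave r₁ r₂ r₃ r₄ t := by
  simp [wave, profile, h.amplitude_neg]

theorem IsChain.waveVel_neg (h : IsChain r₁ r₂ r₃ r₄) (t : ℝ) :
    waveVel r₁ r₂ r₃ r₄ (-t) = -waveVel r₁ r₂ r₃ r₄ t := by
  simp [waveVel, profileVel, h.amplitude_neg, neg_div]

theorem IsChain.wave_zero (h : IsChain r₁ r₂ r₃ r₄) : wave r₁ r₂ r₃ r₄ 0 = r₂ := by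
  simp [wave, profile, h.amplitude_zero]

theorem IsChain.waveVel_sq (h : IsChain r₁ r₂ r₃ r₄) (t : ℝ) :
    waveVel r₁ r₂ r₃ r₄ t ^ 2 = quartic r₁ r₂ r₃ r₄ (wave r₁ r₂ r₃ r₄ t) :=
  h.profileVel_sq _

theorem IsChain.amplitude_crossTime (h : IsChain r₁ r₂ r₃ r₄) (x : ℝ) :
    amplitude r₁ r₂ r₃ r₄ (crossTime r₁ r₂ r₃ r₄ x) =
      Real.arcsin (√(((r₃ - r₁) * (x - r₂)) / ((r₃ - r₂) * (x - r₁)))) := by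
  have hw := h.frequency_pos.ne'
  rw [amplitude, crossTime, mul_div_assoc, mul_div_cancel_left₀ _ two_ne_zero,
    mul_div_cancel₀ _ hw, jacobiAm_ellipticF h.abs_modulus_lt]

theorem IsChain.sub_ne (h : IsChain r₁ r₂ r₃ r₄) {x : ℝ} (hx : (x - r₂) * (x - r₃) ≤ 0) :
    x - r₁ ≠ 0 := by
  intro h0
  have : x = r₁ := by linarith
  subst this
  have := h.mul_pos.2.2.2.1
  nlinarith

theorem IsChain.sin_arcsin_sq (h : IsChain r₁ r₂ r₃ r₄) {x : ℝ} (hx : (x - r₂) * (x - r₃) ≤ 0) :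
    Real.sin (Real.arcsin (√(((r₃ - r₁) * (x - r₂)) / ((r₃ - r₂) * (x - r₁))))) ^ 2 =
      ((r₃ - r₁) * (x - r₂)) / ((r₃ - r₂) * (x - r₁)) := by
  have hx1 := h.sub_ne hx
  obtain ⟨h1, h2, h3, h4⟩ := h.ne
  have key : 0 ≤ ((r₃ - r₁) * (x - r₂)) / ((r₃ - r₂) * (x - r₁)) ∧
      ((r₃ - r₁) * (x - r₂)) / ((r₃ - r₂) * (x - r₁)) ≤ 1 := by
    rcases h with ⟨g1, g2, g3⟩ | ⟨g1, g2, g3⟩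
    · have hx2 : r₂ ≤ x := by by_contra hc; push Not at hc; nlinarith
      have hx3 : x ≤ r₃ := by by_contra hc; push Not at hc; nlinarith
      have hpos : 0 < (r₃ - r₂) * (x - r₁) := _root_.mul_pos (by linarith) (by linarith)
      exact ⟨div_nonneg (mul_nonneg (by linarith) (by linarith)) hpos.le,
        (div_le_one hpos).2 (by nlinarith)⟩
    · have hx2 : x ≤ r₂ := by by_contra hc; push Not at hc; nlinarith
      have hx3 : r₃ ≤ x := by by_contra hc; push Not at hc; nlinarith
      have hpos : 0 < (r₃ - r₂) * (x - r₁) :=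
        mul_pos_of_neg_of_neg (by linarith) (by linarith)
      exact ⟨div_nonneg (mul_nonneg_of_nonpos_of_nonpos (by linarith) (by linarith)) hpos.le,
        (div_le_one hpos).2 (by nlinarith)⟩
  have hs := Real.sqrt_nonneg (((r₃ - r₁) * (x - r₂)) / ((r₃ - r₂) * (x - r₁)))
  rw [Real.sin_arcsin (by linarith) (Real.sqrt_le_one.2 key.2), Real.sq_sqrt key.1]

theorem IsChain.wave_crossTime (h : IsChain r₁ r₂ r₃ r₄) {x : ℝ}
    (hx : (x - r₂) * (x - r₃) ≤ 0) : wave r₁ r₂ r₃ r₄ (crossTime r₁ r₂ r₃ r₄ x) = x := by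
  have hd := (h.denom_pos (amplitude r₁ r₂ r₃ r₄ (crossTime r₁ r₂ r₃ r₄ x))).ne'
  have hx1 := h.sub_ne hx
  obtain ⟨h1, h2, h3, h4⟩ := h.ne
  rw [wave, profile, div_eq_iff hd, h.amplitude_crossTime, h.sin_arcsin_sq hx, ratio]
  field_simp
  ring

theorem IsChain.mul_waveVel_nonneg (h : IsChain r₁ r₂ r₃ r₄) {t : ℝ}
    (h0 : 0 ≤ Real.sin (amplitude r₁ r₂ r₃ r₄ t)) (h1 : 0 ≤ Real.cos (amplitude r₁ r₂ r₃ r₄ t)) :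
    0 ≤ (r₂ - r₁) * waveVel r₁ r₂ r₃ r₄ t := by
  have := h.ratio_pos
  have := h.frequency_pos
  rw [waveVel, profileVel, mul_assoc, mul_assoc, mul_div_assoc, ← mul_assoc, ← sq]
  positivity

theorem IsChain.mul_waveVel_crossTime (h : IsChain r₁ r₂ r₃ r₄) (x : ℝ) :
    0 ≤ (r₂ - r₁) * waveVel r₁ r₂ r₃ r₄ (crossTime r₁ r₂ r₃ r₄ x) := by
  refine h.mul_waveVel_nonneg ?_ ?_ <;> rw [h.amplitude_crossTime]
  · exact Real.sin_nonneg_of_nonneg_of_le_pi (Real.arcsin_nonneg.2 (Real.sqrt_nonneg _))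
      ((Real.arcsin_le_pi_div_two _).trans (by linarith [Real.pi_pos]))
  · exact Real.cos_arcsin_nonneg _

theorem IsChain.crossTime_nonneg (h : IsChain r₁ r₂ r₃ r₄) (x : ℝ) :
    0 ≤ crossTime r₁ r₂ r₃ r₄ x := by
  by_contra hc
  have := h.strictMono_amplitude (not_le.1 hc)
  rw [h.amplitude_crossTime, h.amplitude_zero] at this
  exact absurd (Real.arcsin_nonneg.2 (Real.sqrt_nonneg _)) (not_le.2 this)

/-- The amplitude increases from `0` to an arcsine, hence lies strictly between `0` and `π / 2`,
where every factor of the velocity is positive. -/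
theorem waveVel_pos (h₁₂ : r₁ < r₂) (h₂₃ : r₂ < r₃) (h₃₄ : r₃ < r₄) {x t : ℝ} (ht : 0 < t)
    (htx : t < crossTime r₁ r₂ r₃ r₄ x) : 0 < waveVel r₁ r₂ r₃ r₄ t := by
  have h : IsChain r₁ r₂ r₃ r₄ := Or.inl ⟨h₁₂, h₂₃, h₃₄⟩
  have a0 := h.strictMono_amplitude ht
  have a1 := h.strictMono_amplitude htx
  rw [h.amplitude_zero] at a0
  rw [h.amplitude_crossTime] at a1
  have a2 := Real.arcsin_le_pi_div_two (√(((r₃ - r₁) * (x - r₂)) / ((r₃ - r₂) * (x - r₁))))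
  have hs := Real.sin_pos_of_pos_of_lt_pi a0 (by linarith [Real.pi_pos])
  have hc := Real.cos_pos_of_mem_Ioo
    (x := amplitude r₁ r₂ r₃ r₄ t) ⟨by linarith [Real.pi_pos], by linarith⟩
  have hq := Real.sqrt_pos.2 (one_sub_pos h.abs_modulus_lt (amplitude r₁ r₂ r₃ r₄ t))
  have := h.ratio_pos
  have := h.frequency_pos
  have := h.denom_pos (amplitude r₁ r₂ r₃ r₄ t)
  have := sub_pos.2 h₁₂
  rw [waveVel, profileVel]
  positivity

/-- The travel time from `r₂` to `x` is the integral of the reciprocal velocity. -/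
theorem integral_inv_sqrt_quartic (h₁₂ : r₁ < r₂) (h₂₃ : r₂ < r₃) (h₃₄ : r₃ < r₄) {x : ℝ}
    (hx₂ : r₂ ≤ x) (hx₃ : x ≤ r₃) :
    IntervalIntegrable (fun x => 1 / √(quartic r₁ r₂ r₃ r₄ x)) MeasureTheory.volume r₂ x ∧
    ∫ y in r₂..x, 1 / √(quartic r₁ r₂ r₃ r₄ y) = crossTime r₁ r₂ r₃ r₄ x := by
  have h : IsChain r₁ r₂ r₃ r₄ := Or.inl ⟨h₁₂, h₂₃, h₃₄⟩
  set τ := crossTime r₁ r₂ r₃ r₄ x with hτ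
  have hτ0 : 0 ≤ τ := h.crossTime_nonneg x
  have hx : wave r₁ r₂ r₃ r₄ τ = x := h.wave_crossTime (by nlinarith)
  have hcont : Continuous (wave r₁ r₂ r₃ r₄) :=
    continuous_iff_continuousAt.2 fun t => (h.hasDerivAt_wave t).continuousAt
  have hmono : StrictMonoOn (wave r₁ r₂ r₃ r₄) (Set.Icc 0 τ) := by
    refine strictMonoOn_of_deriv_pos (convex_Icc 0 τ) hcont.continuousOn fun t ht => ?_
    rw [interior_Icc] at ht
    rw [(h.hasDerivAt_wave t).deriv]
    exact waveVel_pos h₁₂ h₂₃ h₃₄ ht.1 ht.2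
  have himg : wave r₁ r₂ r₃ r₄ '' Set.Ioo 0 τ = Set.Ioo r₂ x := by
    apply Set.Subset.antisymm
    · rintro _ ⟨t, ht, rfl⟩
      constructor
      · exact h.wave_zero.symm.trans_lt (hmono ⟨le_rfl, hτ0⟩ ⟨ht.1.le, ht.2.le⟩ ht.1)
      · rw [← hx]
        exact hmono ⟨ht.1.le, ht.2.le⟩ ⟨hτ0, le_rfl⟩ ht.2
    · have := intermediate_value_Ioo hτ0 hcont.continuousOn
      rwa [h.wave_zero, hx] at this
  have hder : ∀ t ∈ Set.Ioo 0 τ, HasDerivWithinAt (wave r₁ r₂ r₃ r₄) (waveVel r₁ r₂ r₃ r₄ t)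
      (Set.Ioo 0 τ) t := fun t _ => (h.hasDerivAt_wave t).hasDerivWithinAt
  have hinj : Set.InjOn (wave r₁ r₂ r₃ r₄) (Set.Ioo 0 τ) :=
    hmono.injOn.mono Set.Ioo_subset_Icc_self
  -- Substituting `x = wave t` turns the integrand into the constant `1`. Working on the open
  -- interval avoids the singular endpoints, and yields convergence along with the value.
  have hone : Set.EqOn (fun t => |waveVel r₁ r₂ r₃ r₄ t| •
      (1 / √(quartic r₁ r₂ r₃ r₄ (wave r₁ r₂ r₃ r₄ t)))) (fun _ => 1) (Set.Ioo 0 τ) := by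
    intro t ht
    have := waveVel_pos h₁₂ h₂₃ h₃₄ ht.1 ht.2
    simp only [← h.waveVel_sq, Real.sqrt_sq_eq_abs, smul_eq_mul]
    exact mul_one_div_cancel (abs_pos.2 this.ne').ne'
  constructor
  · rw [intervalIntegrable_iff_integrableOn_Ioo_of_le hx₂, ← himg,
      MeasureTheory.integrableOn_image_iff_integrableOn_abs_deriv_smul measurableSet_Ioo hder hinj,
      MeasureTheory.integrableOn_congr_fun hone measurableSet_Ioo]
    simp
  · rw [intervalIntegral.integral_of_le hx₂, MeasureTheory.integral_Ioc_eq_integral_Ioo, ← himg,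
      MeasureTheory.integral_image_eq_integral_abs_deriv_smul measurableSet_Ioo hder hinj,
      MeasureTheory.setIntegral_congr_fun measurableSet_Ioo hone]
    simp [hτ0]

end

/-- A bounded motion in a smooth force field is determined by its initial position and velocity. -/
theorem eq_of_hasDerivAt_of_hasDerivAt {g u v u' v' : ℝ → ℝ} (hg : ContDiff ℝ 1 g)
    (hu : ∀ t, HasDerivAt u (u' t) t) (hu' : ∀ t, HasDerivAt u' (g (u t)) t)
    (hv : ∀ t, HasDerivAt v (v' t) t) (hv' : ∀ t, HasDerivAt v' (g (v t)) t)
    {A B M : ℝ} (bu : ∀ t, u t ∈ Set.Icc A B) (bv : ∀ t, v t ∈ Set.Icc A B)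
    (bu' : ∀ t, u' t ∈ Set.Icc (-M) M) (bv' : ∀ t, v' t ∈ Set.Icc (-M) M)
    (h0 : u 0 = v 0) (h0' : u' 0 = v' 0) : u = v := by
  -- The field is only locally Lipschitz; the bounds confine both motions to a compact convex
  -- rectangle, where one constant serves.
  obtain ⟨K, hK⟩ := ContDiffOn.exists_lipschitzOnWith (n := 1)
    (f := fun z : ℝ × ℝ => (z.2, g z.1)) (s := Set.Icc A B ×ˢ Set.Icc (-M) M)
    (contDiff_snd.prodMk (hg.comp contDiff_fst)).contDiffOn one_ne_zero
    ((convex_Icc _ _).prod (convex_Icc _ _)) (isCompact_Icc.prod isCompact_Icc)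
  have := ODE_solution_unique_univ (v := fun _ z => (z.2, g z.1)) (t₀ := 0)
    (s := fun _ => Set.Icc A B ×ˢ Set.Icc (-M) M) (K := K)
    (f := fun t => (u t, u' t)) (g := fun t => (v t, v' t)) (fun _ => hK)
    (fun t => ⟨(hu t).prodMk (hu' t), bu t, bu' t⟩)
    (fun t => ⟨(hv t).prodMk (hv' t), bv t, bv' t⟩) (by simp [h0, h0'])
  funext t
  exact congrArg Prod.fst (congrFun this t)

/-! ### Closed components of the level sets -/

/-- The characteristic polynomial is the discriminant of `H = h` as a quadratic in `p`, and the
bracket is `∂H/∂p`. -/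
theorem charPoly_eq_sq (a : ℝ) (w : ℝ × ℝ) :
    charPoly a (invariant a w) w.1 = (2 * (w.1 + 1) * w.2 + (w.1 ^ 2 - a * w.1)) ^ 2 := by
  rw [charPoly, invariant]
  ring

theorem invariant_swap (a : ℝ) (w : ℝ × ℝ) : invariant a w.swap = invariant a w := by
  simp only [invariant, Prod.fst_swap, Prod.snd_swap]
  ring

theorem continuous_charPoly (a h : ℝ) : Continuous (charPoly a h) := by
  unfold charPoly
  fun_prop

theorem finite_charPoly_eq_zero (a h : ℝ) : {x | charPoly a h x = 0}.Finite := by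
  let p : Polynomial ℝ := Polynomial.X ^ 4 - Polynomial.C (2 * (2 + a)) * Polynomial.X ^ 3 +
    Polynomial.C (a ^ 2 - 4) * Polynomial.X ^ 2 + Polynomial.C (4 * h) * Polynomial.X +
    Polynomial.C (4 * h)
  have hp : p ≠ 0 := by
    have : p.Monic := by
      unfold p
      monicity!
    exact this.ne_zero
  refine (Polynomial.finite_setOfPred_isRoot hp).subset fun x hx => ?_
  simpa [p, Polynomial.IsRoot, charPoly] using hx

/-- `C` is a connected component of the level set `{H = h}` that is compact and has more than one
point. -/
structure IsClosedComponent (a h : ℝ) (C : Set (ℝ × ℝ)) : Prop where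
  subset_level : ∀ w ∈ C, invariant a w = h
  isPreconnected : IsPreconnected C
  isCompact : IsCompact C
  nontrivial : C.Nontrivial
  maximal : ∀ S : Set (ℝ × ℝ), IsPreconnected S → (∀ w ∈ S, invariant a w = h) →
    (S ∩ C).Nonempty → S ⊆ C

/-- Of the circle only compactness and the presence of two points are used. -/
theorem OnClosedInvariantCurve.isClosedComponent {a : ℝ} {z : ℝ × ℝ}
    (hz : OnClosedInvariantCurve a z) : IsClosedComponent a (invariant a z)
      (connectedComponentIn {w : ℝ × ℝ | invariant a w = invariant a z} z) := by
  obtain ⟨e⟩ := hz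
  refine ⟨fun w hw =>
    (connectedComponentIn_subset _ _ hw : w ∈ {w : ℝ × ℝ | invariant a w = invariant a z}),
    isPreconnected_connectedComponentIn,
    isCompact_iff_compactSpace.2 e.symm.compactSpace, ?_, ?_⟩
  · refine ⟨e.symm 1, (e.symm 1).2, e.symm (-1), (e.symm (-1)).2, fun h => ?_⟩
    have h1 := congrArg (fun z : Circle => (z : ℂ)) (e.symm.injective (Subtype.ext h))
    norm_num at h1
  · rintro S hS hlev ⟨w, hwS, hwC⟩
    rw [connectedComponentIn_eq hwC]
    exact hS.subset_connectedComponentIn hwS hlev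

/-- The branch with sign `σ` of the level set `{H = h}`, as a graph over the first coordinate. -/
def branch (a h σ q : ℝ) : ℝ := (-(q ^ 2 - a * q) + σ * √(charPoly a h q)) / (2 * (q + 1))

theorem invariant_branch {a h σ q : ℝ} (hσ : σ ^ 2 = 1) (hq : q ≠ -1) (hP : 0 ≤ charPoly a h q) :
    invariant a (q, branch a h σ q) = h := by
  have hq1 : q + 1 ≠ 0 := fun h0 => hq (by linarith)
  have h2 : 2 * (q + 1) * branch a h σ q + (q ^ 2 - a * q) = σ * √(charPoly a h q) := by
    rw [branch, mul_div_cancel₀ _ (by simpa using hq1)]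
    ring
  have h3 : charPoly a (invariant a (q, branch a h σ q)) q = charPoly a h q := by
    rw [charPoly_eq_sq a (q, branch a h σ q)]
    simp only
    rw [h2, mul_pow, hσ, Real.sq_sqrt hP, one_mul]
  -- For fixed `q` the characteristic polynomial is affine in `h` with slope `4 * (q + 1)`, so away
  -- from `q = -1` its value determines the level.
  have h4 : 4 * (q + 1) * (invariant a (q, branch a h σ q) - h) = 0 := by
    rw [charPoly, charPoly] at h3
    linear_combination h3
  have := (mul_eq_zero.1 h4).resolve_left (by simpa using hq1)
  linarith

theorem exists_eq_branch {a : ℝ} {w : ℝ × ℝ} (hq : w.1 ≠ -1) :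
    ∃ σ : ℝ, σ ^ 2 = 1 ∧ w.2 = branch a (invariant a w) σ w.1 := by
  have hq1 : w.1 + 1 ≠ 0 := fun h0 => hq (by linarith)
  have key (σ : ℝ) (h : σ * √(charPoly a (invariant a w) w.1) =
      2 * (w.1 + 1) * w.2 + (w.1 ^ 2 - a * w.1)) : w.2 = branch a (invariant a w) σ w.1 := by
    rw [branch, h]
    field_simp
    ring
  rw [charPoly_eq_sq, Real.sqrt_sq_eq_abs] at key
  rcases le_total 0 (2 * (w.1 + 1) * w.2 + (w.1 ^ 2 - a * w.1)) with h | h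
  · exact ⟨1, by norm_num, key 1 (by rw [abs_of_nonneg h]; ring)⟩
  · exact ⟨-1, by norm_num, key (-1) (by rw [abs_of_nonpos h]; ring)⟩

theorem continuousOn_branch {a h σ : ℝ} {J : Set ℝ} (hJ : -1 ∉ J) :
    ContinuousOn (fun q => (q, branch a h σ q)) J := by
  unfold branch
  refine continuousOn_id.prodMk (ContinuousOn.div ?_ (by fun_prop) fun q hq => ?_)
  · have := continuous_charPoly a h
    fun_prop
  · have : q + 1 ≠ 0 := fun h0 => hJ (by rwa [← show q = -1 by linarith])
    simpa using this

/-- A characteristic polynomial with four distinct real roots factors. -/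
theorem charPoly_eq_quartic {a h r₁ r₂ r₃ r₄ : ℝ} (h₁₂ : r₁ < r₂) (h₂₃ : r₂ < r₃) (h₃₄ : r₃ < r₄)
    (e₁ : charPoly a h r₁ = 0) (e₂ : charPoly a h r₂ = 0) (e₃ : charPoly a h r₃ = 0)
    (e₄ : charPoly a h r₄ = 0) :
    r₁ + r₂ + r₃ + r₄ = 2 * (2 + a) ∧ ∀ x, charPoly a h x = quartic r₁ r₂ r₃ r₄ x := by
  have key : ∃ α β γ δ : ℝ, (α = r₁ + r₂ + r₃ + r₄ - 2 * (2 + a)) ∧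
      ∀ x, charPoly a h x - quartic r₁ r₂ r₃ r₄ x = α * x ^ 3 + β * x ^ 2 + γ * x + δ :=
    ⟨_, a ^ 2 - 4 - (r₁ * r₂ + r₁ * r₃ + r₁ * r₄ + r₂ * r₃ + r₂ * r₄ + r₃ * r₄),
      4 * h + (r₁ * r₂ * r₃ + r₁ * r₂ * r₄ + r₁ * r₃ * r₄ + r₂ * r₃ * r₄),
      4 * h - r₁ * r₂ * r₃ * r₄, rfl, fun x => by rw [charPoly, quartic]; ring⟩
  obtain ⟨α, β, γ, δ, hα, hx⟩ := key
  have f₁ := hx r₁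
  have f₂ := hx r₂
  have f₃ := hx r₃
  have f₄ := hx r₄
  rw [e₁, quartic] at f₁
  rw [e₂, quartic] at f₂
  rw [e₃, quartic] at f₃
  rw [e₄, quartic] at f₄
  -- The difference is at most cubic and vanishes at four points; successive divided differences
  -- kill its coefficients. The vanishing of `α` is the formula for the sum of the roots.
  have g₁₂ : α * (r₁ ^ 2 + r₁ * r₂ + r₂ ^ 2) + β * (r₁ + r₂) + γ = 0 :=
    mul_left_cancel₀ (sub_ne_zero.2 h₁₂.ne) (by linear_combination f₂ - f₁)
  have g₂₃ : α * (r₂ ^ 2 + r₂ * r₃ + r₃ ^ 2) + β * (r₂ + r₃) + γ = 0 :=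
    mul_left_cancel₀ (sub_ne_zero.2 h₂₃.ne) (by linear_combination f₃ - f₂)
  have g₃₄ : α * (r₃ ^ 2 + r₃ * r₄ + r₄ ^ 2) + β * (r₃ + r₄) + γ = 0 :=
    mul_left_cancel₀ (sub_ne_zero.2 h₃₄.ne) (by linear_combination f₄ - f₃)
  have k₁ : α * (r₁ + r₂ + r₃) + β = 0 :=
    mul_left_cancel₀ (sub_ne_zero.2 (h₁₂.trans h₂₃).ne) (by linear_combination g₁₂ - g₂₃)
  have k₂ : α * (r₂ + r₃ + r₄) + β = 0 :=
    mul_left_cancel₀ (sub_ne_zero.2 (h₂₃.trans h₃₄).ne) (by linear_combination g₂₃ - g₃₄)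
  have l : α = 0 := mul_left_cancel₀ (sub_ne_zero.2 ((h₁₂.trans h₂₃).trans h₃₄).ne)
    (by linear_combination k₁ - k₂)
  have hβ : β = 0 := by linear_combination k₁ - (r₁ + r₂ + r₃) * l
  have hγ : γ = 0 := by
    linear_combination g₁₂ - (r₁ + r₂) * hβ - (r₁ ^ 2 + r₁ * r₂ + r₂ ^ 2) * l
  have hδ : δ = 0 := by
    linear_combination -f₁ - r₁ * hγ - r₁ ^ 2 * hβ - r₁ ^ 3 * l
  refine ⟨by linarith, fun x => ?_⟩
  linear_combination hx x + x ^ 3 * l + x ^ 2 * hβ + x * hγ + hδ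

/-! ### Sign changes forced by compactness of the component. -/

theorem exists_first_zero {f : ℝ → ℝ} (hf : Continuous f) {u v : ℝ} (huv : u < v)
    (hu : 0 ≤ f u) (hv : f v < 0) : ∃ r ∈ Set.Ico u v, f r = 0 ∧ ∀ x ∈ Set.Icc u r, 0 ≤ f x := by
  obtain ⟨r, ⟨⟨hr1, hr2⟩, hr3⟩, hr⟩ := (isCompact_Icc.inter_right
    (isClosed_le hf continuous_const) : IsCompact (Set.Icc u v ∩ {x | f x ≤ 0})).exists_isLeast
    ⟨v, ⟨huv.le, le_rfl⟩, hv.le⟩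
  have hlt : ∀ x ∈ Set.Ico u r, 0 ≤ f x := fun x hx => by
    by_contra hc
    exact absurd (hr ⟨⟨hx.1, hx.2.le.trans hr2⟩, (not_le.1 hc).le⟩) (not_le.2 hx.2)
  have hr0 : 0 ≤ f r := by
    rcases hr1.eq_or_lt with rfl | h
    · exact hu
    · have : Set.Icc u r ⊆ {x | 0 ≤ f x} := by
        rw [← closure_Ico h.ne]
        exact closure_minimal hlt (isClosed_le continuous_const hf)
      exact this ⟨hr1, le_rfl⟩
  refine ⟨r, ⟨hr1, hr2.lt_of_ne ?_⟩, le_antisymm hr3 hr0, fun x hx => ?_⟩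
  · rintro rfl
    linarith
  · rcases hx.2.eq_or_lt with rfl | h
    · exact hr0
    · exact hlt x ⟨hx.1, h⟩

theorem exists_last_zero {f : ℝ → ℝ} (hf : Continuous f) {u v : ℝ} (huv : v < u)
    (hu : 0 ≤ f u) (hv : f v < 0) : ∃ r ∈ Set.Ioc v u, f r = 0 ∧ ∀ x ∈ Set.Icc r u, 0 ≤ f x := by
  obtain ⟨r, hr, hr0, h⟩ := exists_first_zero (f := fun x => f (-x)) (by fun_prop)
    (neg_lt_neg huv) (by simpa using hu) (by simpa using hv)
  exact ⟨-r, ⟨by linarith [hr.2], by linarith [hr.1]⟩, hr0, fun x hx => by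
    simpa using h (-x) ⟨by linarith [hx.2], by linarith [hx.1]⟩⟩

namespace IsClosedComponent

variable {a h : ℝ} {C : Set (ℝ × ℝ)}

theorem charPoly_nonneg (hC : IsClosedComponent a h C) {w : ℝ × ℝ} (hw : w ∈ C) :
    0 ≤ charPoly a h w.1 := by
  rw [← hC.subset_level w hw, charPoly_eq_sq]
  exact sq_nonneg _

theorem exists_bound (hC : IsClosedComponent a h C) :
    ∃ M, ∀ w ∈ C, |w.1| ≤ M ∧ |w.2| ≤ M := by
  obtain ⟨M, hM⟩ := hC.isCompact.isBounded.exists_norm_le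
  exact ⟨M, fun w hw => ⟨(norm_fst_le w).trans (hM w hw), (norm_snd_le w).trans (hM w hw)⟩⟩

theorem graph_subset (hC : IsClosedComponent a h C) {J : Set ℝ} (hJ : IsPreconnected J)
    (hJ1 : -1 ∉ J) (hP : ∀ q ∈ J, 0 ≤ charPoly a h q) {σ : ℝ} (hσ : σ ^ 2 = 1) {q₀ : ℝ}
    (hq₀ : q₀ ∈ J) (hmem : (q₀, branch a h σ q₀) ∈ C) {q : ℝ} (hq : q ∈ J) :
    (q, branch a h σ q) ∈ C := by
  have hne : ∀ q ∈ J, q ≠ -1 := fun q hq h0 => hJ1 (h0 ▸ hq)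
  refine hC.maximal _ (hJ.image _ (continuousOn_branch (a := a) (h := h) (σ := σ) hJ1)) ?_
    ⟨_, ⟨q₀, hq₀, rfl⟩, hmem⟩ ⟨q, hq, rfl⟩
  rintro _ ⟨x, hx, rfl⟩
  exact invariant_branch hσ (hne x hx) (hP x hx)

/-- A branch over an interval that avoids `-1` is a connected subset of the level, so by maximality
the component swallows it as soon as they meet. -/
theorem exists_graph_subset (hC : IsClosedComponent a h C) {J : Set ℝ} (hJ : IsPreconnected J)
    (hJ1 : -1 ∉ J) (hP : ∀ q ∈ J, 0 ≤ charPoly a h q) {w : ℝ × ℝ} (hw : w ∈ C) (hwJ : w.1 ∈ J) :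
    ∃ σ : ℝ, σ ^ 2 = 1 ∧ ∀ q ∈ J, (q, branch a h σ q) ∈ C := by
  obtain ⟨σ, hσ, he⟩ := exists_eq_branch (a := a) (w := w) fun h0 => hJ1 (h0 ▸ hwJ)
  rw [hC.subset_level w hw] at he
  exact ⟨σ, hσ, fun q hq => hC.graph_subset hJ hJ1 hP hσ hwJ (by rwa [← he]) hq⟩

/-- Over an interval that contains a turning point, both branches lie on the component. -/
theorem mem_of_level (hC : IsClosedComponent a h C) {J : Set ℝ} (hJ : IsPreconnected J)
    (hJ1 : -1 ∉ J) (hP : ∀ q ∈ J, 0 ≤ charPoly a h q) {r : ℝ} (hr : r ∈ J)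
    (hr0 : charPoly a h r = 0) {w : ℝ × ℝ} (hw : w ∈ C) (hwJ : w.1 ∈ J) {v : ℝ × ℝ}
    (hv : invariant a v = h) (hvJ : v.1 ∈ J) : v ∈ C := by
  obtain ⟨σ, hσ, hg⟩ := hC.exists_graph_subset hJ hJ1 hP hw hwJ
  obtain ⟨τ, hτ, he⟩ := exists_eq_branch (a := a) (w := v) fun h0 => hJ1 (h0 ▸ hvJ)
  rw [hv] at he
  -- The branches coincide at a turning point, so one may change sign there.
  have hrC : (r, branch a h τ r) ∈ C := by
    have := hg r hr
    simpa [branch, hr0] using this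
  have := hC.graph_subset hJ hJ1 hP hτ hr hrC hvJ
  rwa [← he] at this

/-- Otherwise a branch over a whole half-line would lie in the bounded component. -/
theorem exists_neg_right (hC : IsClosedComponent a h C) {w : ℝ × ℝ} (hw : w ∈ C)
    (hw1 : -1 < w.1) : ∃ x, w.1 < x ∧ charPoly a h x < 0 := by
  by_contra! hc
  have hP : ∀ q ∈ Set.Ici w.1, 0 ≤ charPoly a h q := fun q hq => by
    rcases (Set.mem_Ici.1 hq).eq_or_lt with h0 | h0
    · exact h0 ▸ hC.charPoly_nonneg hw
    · exact hc q h0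
  obtain ⟨σ, -, hg⟩ := hC.exists_graph_subset isPreconnected_Ici
    (by simpa using hw1) hP hw Set.self_mem_Ici
  obtain ⟨M, hM⟩ := hC.exists_bound
  have h1 := (hM _ (hg (|w.1| + |M| + 1) (by
    simp only [Set.mem_Ici]; linarith [le_abs_self w.1, abs_nonneg M]))).1
  have := le_abs_self (|w.1| + |M| + 1)
  simp only at h1
  linarith [abs_nonneg w.1, le_abs_self M]

theorem exists_neg_left (hC : IsClosedComponent a h C) {w : ℝ × ℝ} (hw : w ∈ C)
    (hw1 : w.1 < -1) : ∃ x, x < w.1 ∧ charPoly a h x < 0 := by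
  by_contra! hc
  have hP : ∀ q ∈ Set.Iic w.1, 0 ≤ charPoly a h q := fun q hq => by
    rcases (Set.mem_Iic.1 hq).eq_or_lt with h0 | h0
    · exact h0 ▸ hC.charPoly_nonneg hw
    · exact hc q h0
  obtain ⟨σ, -, hg⟩ := hC.exists_graph_subset isPreconnected_Iic
    (by simpa using hw1) hP hw Set.self_mem_Iic
  obtain ⟨M, hM⟩ := hC.exists_bound
  have h1 := (hM _ (hg (-(|w.1| + |M| + 1)) (by
    simp only [Set.mem_Iic]; linarith [neg_abs_le w.1, abs_nonneg M]))).1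
  have := neg_abs_le (-(|w.1| + |M| + 1))
  simp only at h1
  linarith [abs_nonneg w.1, le_abs_self M]

/-- A closed component reaches the line `q = -1` along both branches only on the completely
reducible level. -/
theorem eq_of_mem_closure (hC : IsClosedComponent a h C) {J : Set ℝ} (hJ : IsPreconnected J)
    (hJ1 : -1 ∉ J) (hJc : -1 ∈ closure J) (hP : ∀ q ∈ J, 0 ≤ charPoly a h q) {r : ℝ} (hr : r ∈ J)
    (hr0 : charPoly a h r = 0) {w : ℝ × ℝ} (hw : w ∈ C) (hwJ : w.1 ∈ J) : a = -1 ∧ h = 1 := by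
  have hne : ∀ q ∈ J, q + 1 ≠ 0 := fun q hq h0 => hJ1 (by rwa [← show q = -1 by linarith])
  obtain ⟨M, hM⟩ := hC.exists_bound
  have hb (σ : ℝ) (hσ : σ ^ 2 = 1) (q : ℝ) (hq : q ∈ J) : |branch a h σ q| ≤ M :=
    (hM _ (hC.mem_of_level hJ hJ1 hP hr hr0 hw hwJ
      (invariant_branch hσ (fun h0 => hne q hq (by linarith)) (hP q hq)) hq)).2
  -- By Vieta the two branch values have sum `-(q² - a q) / (q + 1)` and product `(q² - h) / (q +
  -- 1)`. Both stay bounded, so both numerators vanish in the limit `q = -1`.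
  have h1 : closure J ⊆ {q : ℝ | |q ^ 2 - a * q| ≤ |q + 1| * (2 * M)} := by
    refine closure_minimal (fun q hq => ?_) (isClosed_le (by fun_prop) (by fun_prop))
    have hsum : q ^ 2 - a * q = -((q + 1) * (branch a h 1 q + branch a h (-1) q)) := by
      have := hne q hq
      rw [branch, branch]
      field_simp
      ring
    rw [Set.mem_ofPred_eq, hsum, abs_neg, abs_mul]
    have := abs_add_le (branch a h 1 q) (branch a h (-1) q)
    gcongr
    linarith [hb 1 (by norm_num) q hq, hb (-1) (by norm_num) q hq]
  have h2 : closure J ⊆ {q : ℝ | |q ^ 2 - h| ≤ |q + 1| * (M * M)} := by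
    refine closure_minimal (fun q hq => ?_) (isClosed_le (by fun_prop) (by fun_prop))
    have hprod : q ^ 2 - h = (q + 1) * (branch a h 1 q * branch a h (-1) q) := by
      have := hne q hq
      have hs : √(charPoly a h q) * √(charPoly a h q) = q ^ 4 - 2 * (2 + a) * q ^ 3 +
        (a ^ 2 - 4) * q ^ 2 + 4 * h * q + 4 * h := Real.mul_self_sqrt (hP q hq)
      rw [branch, branch]
      field_simp
      linear_combination hs
    rw [Set.mem_ofPred_eq, hprod, abs_mul, abs_mul]
    have hb1 := hb 1 (by norm_num) q hq
    have hb2 := hb (-1) (by norm_num) q hq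
    have := (abs_nonneg _).trans hb1
    gcongr
  have e1 := h1 hJc
  have e2 := h2 hJc
  simp only [Set.mem_ofPred_eq, neg_add_cancel, abs_zero, zero_mul, abs_nonpos_iff] at e1 e2
  constructor <;> linarith

theorem false_of_reducible_level {x : ℝ} (hx : charPoly a h x < 0) (ha : a = -1) (hh : h = 1) :
    False := by
  subst ha hh
  have : charPoly (-1) 1 x = ((x + 1) * (x - 2)) ^ 2 := by
    rw [charPoly]; ring
  nlinarith [sq_nonneg ((x + 1) * (x - 2))]

/-- Otherwise the polynomial is nonnegative from `-1` up to the next zero on the right. Both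
branches then belong to the component all the way to the pole, which forces a level where the
polynomial is a square, contradicting its negative value further right. -/
theorem exists_neg_between (hC : IsClosedComponent a h C) {w : ℝ × ℝ} (hw : w ∈ C)
    (hw1 : -1 < w.1) : ∃ y, -1 < y ∧ y < w.1 ∧ charPoly a h y < 0 := by
  by_contra! hc
  obtain ⟨x, hx, hx0⟩ := hC.exists_neg_right hw hw1
  obtain ⟨r, hr, hr0, hr'⟩ := exists_first_zero (continuous_charPoly a h) hx
    (hC.charPoly_nonneg hw) hx0
  have h1 : -1 < r := hw1.trans_le hr.1
  obtain ⟨ha, hh⟩ := hC.eq_of_mem_closure (J := Set.Ioc (-1) r) isPreconnected_Ioc (by simp)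
    (by rw [closure_Ioc h1.ne]; exact ⟨le_rfl, h1.le⟩)
    (fun q hq => by
      rcases lt_or_ge q w.1 with h2 | h2
      · exact hc q hq.1 h2
      · exact hr' q ⟨h2, hq.2⟩) ⟨h1, le_rfl⟩ hr0 hw ⟨hw1, hr.1⟩
  exact false_of_reducible_level hx0 ha hh

theorem exists_zero_of_sign {u v : ℝ} (huv : u ≤ v)
    (h0 : charPoly a h u * charPoly a h v ≤ 0) : ∃ r ∈ Set.Icc u v, charPoly a h r = 0 := by
  have hc := (continuous_charPoly a h).continuousOn (s := Set.Icc u v)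
  rcases mul_nonpos_iff.1 h0 with ⟨h1, h2⟩ | ⟨h1, h2⟩
  · exact intermediate_value_Icc' huv hc ⟨h2, h1⟩
  · exact intermediate_value_Icc huv hc ⟨h1, h2⟩

/-- Alternating signs at five points give four distinct roots. -/
theorem exists_roots {x₀ x₁ x₂ x₃ x₄ : ℝ} (h₀₁ : x₀ < x₁) (h₁₂ : x₁ < x₂) (h₂₃ : x₂ < x₃)
    (h₃₄ : x₃ < x₄) (s₀ : 0 ≤ charPoly a h x₀) (s₁ : charPoly a h x₁ < 0)
    (s₂ : 0 < charPoly a h x₂) (s₃ : charPoly a h x₃ < 0) (s₄ : 0 ≤ charPoly a h x₄) :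
    ∃ r₁ r₂ r₃ r₄, x₀ ≤ r₁ ∧ r₁ < x₁ ∧ x₁ < r₂ ∧ r₂ < x₂ ∧ x₂ < r₃ ∧ r₃ < x₃ ∧ x₃ < r₄ ∧ r₄ ≤ x₄ ∧
      r₁ + r₂ + r₃ + r₄ = 2 * (2 + a) ∧ ∀ x, charPoly a h x = quartic r₁ r₂ r₃ r₄ x := by
  obtain ⟨r₁, hr₁, e₁⟩ := exists_zero_of_sign h₀₁.le (mul_nonpos_of_nonneg_of_nonpos s₀ s₁.le)
  obtain ⟨r₂, hr₂, e₂⟩ := exists_zero_of_sign h₁₂.le (mul_nonpos_of_nonpos_of_nonneg s₁.le s₂.le)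
  obtain ⟨r₃, hr₃, e₃⟩ := exists_zero_of_sign h₂₃.le (mul_nonpos_of_nonneg_of_nonpos s₂.le s₃.le)
  obtain ⟨r₄, hr₄, e₄⟩ := exists_zero_of_sign h₃₄.le (mul_nonpos_of_nonpos_of_nonneg s₃.le s₄)
  have key {r x : ℝ} (hr : charPoly a h r = 0) (hx : charPoly a h x ≠ 0) : r ≠ x := by
    rintro rfl
    exact hx hr
  have a₁ := hr₁.2.lt_of_ne (key e₁ s₁.ne)
  have a₂ := hr₂.1.lt_of_ne (key e₂ s₁.ne).symm
  have a₃ := hr₂.2.lt_of_ne (key e₂ s₂.ne')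
  have a₄ := hr₃.1.lt_of_ne (key e₃ s₂.ne').symm
  have a₅ := hr₃.2.lt_of_ne (key e₃ s₃.ne)
  have a₆ := hr₄.1.lt_of_ne (key e₄ s₃.ne).symm
  exact ⟨r₁, r₂, r₃, r₄, hr₁.1, a₁, a₂, a₃, a₄, a₅, a₆, hr₄.2,
    charPoly_eq_quartic (a₁.trans a₂) (a₃.trans a₄) (a₅.trans a₆) e₁ e₂ e₃ e₄⟩

theorem charPoly_neg_one_nonneg (a h : ℝ) : 0 ≤ charPoly a h (-1) := by
  rw [show charPoly a h (-1) = (a + 1) ^ 2 by rw [charPoly]; ring]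
  exact sq_nonneg _

theorem exists_nonneg_left (a h x : ℝ) : ∃ y < x, 0 ≤ charPoly a h y := by
  refine ⟨-(1 + |h| + |x|), by linarith [neg_abs_le x, abs_nonneg h], ?_⟩
  have hN : 1 + |h| ≤ 1 + |h| + |x| := by linarith [abs_nonneg x]
  generalize 1 + |h| + |x| = N at *
  have h1 : charPoly a h (-N) = (N ^ 2 + a * N) ^ 2 + 4 * (N - 1) * (N ^ 2 - h) := by
    rw [charPoly]; ring
  have h2 := le_abs_self h
  have h3 := abs_nonneg h
  rw [h1]
  have : 0 ≤ N ^ 2 - h := by nlinarith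
  have : 0 ≤ N - 1 := by linarith
  positivity

theorem exists_nonneg_right (ha' : a < 2) (h x : ℝ) :
    ∃ y > x, 0 ≤ charPoly a h y := by
  refine ⟨10 + |h| + |x|, by linarith [le_abs_self x, abs_nonneg h], ?_⟩
  have hN : 10 + |h| ≤ 10 + |h| + |x| := by linarith [abs_nonneg x]
  generalize 10 + |h| + |x| = N at *
  have h2 := neg_abs_le h
  have h3 := abs_nonneg h
  have h4 : -(4 * N ^ 2 + 4 * N) ≤ 4 * h * N + 4 * h := by nlinarith
  have h5 : -(8 * N ^ 3) ≤ -(2 * (2 + a) * N ^ 3) := by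
    have : 0 ≤ N ^ 3 := by have : 0 ≤ N := by linarith
                           positivity
    nlinarith
  have h6 : -(4 * N ^ 2) ≤ (a ^ 2 - 4) * N ^ 2 := by nlinarith [sq_nonneg (a * N)]
  have h7 : 0 ≤ N ^ 4 - 8 * N ^ 3 - 8 * N ^ 2 - 4 * N := by
    have : N ^ 4 - 8 * N ^ 3 - 8 * N ^ 2 - 4 * N =
      N * ((N - 10) ^ 3 + 22 * (N - 10) ^ 2 + 132 * (N - 10) + 116) := by ring
    rw [this]
    have : 0 ≤ N - 10 := by linarith
    have : 0 ≤ N := by linarith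
    positivity
  rw [charPoly]
  linarith

/-- Either the component reaches the pole from the left along both branches, which is excluded as
before, or the polynomial is negative somewhere before `-1`. In the latter case all four roots are
at most `-1`, although their sum `2 * (2 + a)` is positive. -/
theorem not_lt_neg_one (hC : IsClosedComponent a h C) (ha : -2 < a) {w : ℝ × ℝ} (hw : w ∈ C)
    (hw0 : 0 < charPoly a h w.1) : ¬ w.1 < -1 := by
  intro hw1
  obtain ⟨x, hx, hx0⟩ := hC.exists_neg_left hw hw1
  obtain ⟨r, hr, hr0, hr'⟩ := exists_last_zero (continuous_charPoly a h) hx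
    (hC.charPoly_nonneg hw) hx0
  have h1 : r < -1 := hr.2.trans_lt hw1
  have hP : ∀ q ∈ Set.Ico r (-1), 0 ≤ charPoly a h q := fun q hq => by
    rcases le_or_gt q w.1 with h2 | h2
    · exact hr' q ⟨hq.1, h2⟩
    · by_contra hc
      obtain ⟨y, hy, hy0⟩ := exists_nonneg_left a h x
      obtain ⟨r₁, r₂, r₃, r₄, -, b₁, -, b₂, -, b₃, -, b₄, b₅, -⟩ := exists_roots hy hx h2 hq.2 hy0
        hx0 hw0 (not_le.1 hc) (charPoly_neg_one_nonneg a h)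
      have := hq.2
      linarith
  obtain ⟨ha1, hh⟩ := hC.eq_of_mem_closure isPreconnected_Ico (by simp)
    (by rw [closure_Ico h1.ne]; exact ⟨h1.le, le_rfl⟩) hP ⟨le_rfl, h1⟩ hr0 hw ⟨hr.2, hw1⟩
  exact false_of_reducible_level hx0 ha1 hh

/-- A nondegenerate projection contains infinitely many points, of which only finitely many are
zeros or `-1`. If the projection is a single point, the quadratic in `p` has three roots there, so
it vanishes identically and the component contains an unbounded vertical line. -/
theorem exists_charPoly_pos (hC : IsClosedComponent a h C) :
    ∃ w ∈ C, w.1 ≠ -1 ∧ 0 < charPoly a h w.1 := by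
  obtain ⟨u, hu, v, hv, huv⟩ := hC.nontrivial
  have hproj := hC.isPreconnected.image Prod.fst continuous_fst.continuousOn
  have key {x y : ℝ} (hx : x ∈ Prod.fst '' C) (hy : y ∈ Prod.fst '' C) (hxy : x < y) :
      ∃ w ∈ C, w.1 ≠ -1 ∧ 0 < charPoly a h w.1 := by
    have hfin : ({x | charPoly a h x = 0} ∪ {-1}).Finite :=
      (finite_charPoly_eq_zero a h).union (Set.finite_singleton _)
    obtain ⟨q, hq, hq'⟩ := ((Set.Icc_infinite hxy).sdiff hfin).nonempty
    obtain ⟨w, hw, rfl⟩ := hproj.Icc_subset hx hy hq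
    simp only [Set.mem_union, Set.mem_ofPred_eq, Set.mem_singleton_iff, not_or] at hq'
    exact ⟨w, hw, hq'.2, (hC.charPoly_nonneg hw).lt_of_ne (Ne.symm hq'.1)⟩
  by_contra hc
  have hconst : ∀ w ∈ C, w.1 = u.1 := fun w hw => by
    by_contra hne
    rcases lt_or_gt_of_ne hne with h1 | h1
    · exact hc (key ⟨w, hw, rfl⟩ ⟨u, hu, rfl⟩ h1)
    · exact hc (key ⟨u, hu, rfl⟩ ⟨w, hw, rfl⟩ h1)
  have hne : u.2 ≠ v.2 := fun h0 => huv (Prod.ext (hconst v hv).symm h0)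
  have hmid : ∃ m ∈ C, m.2 = (u.2 + v.2) / 2 := by
    have hproj2 := hC.isPreconnected.image Prod.snd continuous_snd.continuousOn
    have := hproj2.ordConnected.uIcc_subset ⟨u, hu, rfl⟩ ⟨v, hv, rfl⟩
      (show (u.2 + v.2) / 2 ∈ Set.uIcc u.2 v.2 by
        rcases le_total u.2 v.2 with h0 | h0
        · rw [Set.uIcc_of_le h0]; constructor <;> linarith
        · rw [Set.uIcc_of_ge h0]; constructor <;> linarith)
    obtain ⟨m, hm, hm2⟩ := this
    exact ⟨m, hm, hm2⟩
  obtain ⟨m, hm, hm2⟩ := hmid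
  have eu := hC.subset_level u hu
  have ev := hC.subset_level v hv
  have em := hC.subset_level m hm
  rw [invariant] at eu ev em
  rw [hconst v hv] at ev
  rw [hconst m hm, hm2] at em
  have h1 : u.1 + 1 = 0 := by
    have : (u.2 - v.2) ^ 2 * (u.1 + 1) = 0 := by linear_combination 2 * eu + 2 * ev - 4 * em
    exact (mul_eq_zero.1 this).resolve_left (pow_ne_zero 2 (sub_ne_zero.2 hne))
  have h2 : u.1 ^ 2 - a * u.1 = 0 := by
    have : (u.2 - v.2) * (u.1 ^ 2 - a * u.1) = 0 := by
      linear_combination eu - ev - (u.2 ^ 2 - v.2 ^ 2) * h1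
    exact (mul_eq_zero.1 this).resolve_left (sub_ne_zero.2 hne)
  have h3 : u.1 ^ 2 = h := by linear_combination eu - u.2 ^ 2 * h1 - u.2 * h2
  have hline : (fun p : ℝ => (u.1, p)) '' Set.univ ⊆ C := by
    refine hC.maximal _ (isPreconnected_univ.image _ (by fun_prop)) ?_
      ⟨u, ⟨u.2, trivial, rfl⟩, hu⟩
    rintro _ ⟨p, -, rfl⟩
    rw [invariant]
    linear_combination p ^ 2 * h1 + p * h2 + h3
  obtain ⟨M, hM⟩ := hC.exists_bound
  have := (hM _ (hline ⟨|M| + 1, trivial, rfl⟩)).2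
  simp only at this
  linarith [le_abs_self (|M| + 1), le_abs_self M]

/-- On the level of a closed component the characteristic polynomial has four distinct real
roots. -/
theorem exists_roots_of_component (hC : IsClosedComponent a h C) (ha : -2 < a) (ha' : a < 2) :
    ∃ r₁ r₂ r₃ r₄, r₁ < r₂ ∧ r₂ < r₃ ∧ r₃ < r₄ ∧ -1 < r₂ ∧
      (∀ x, charPoly a h x = quartic r₁ r₂ r₃ r₄ x) := by
  obtain ⟨w, hw, hne, hw0⟩ := hC.exists_charPoly_pos
  have hw1 : -1 < w.1 := (not_lt.1 (hC.not_lt_neg_one ha hw hw0)).lt_of_ne hne.symm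
  obtain ⟨x, hx, hx0⟩ := hC.exists_neg_right hw hw1
  obtain ⟨y, hy1, hy, hy0⟩ := hC.exists_neg_between hw hw1
  obtain ⟨z, hz, hz0⟩ := exists_nonneg_right ha' h x
  -- The leftmost sample point is `-1` itself, where the polynomial equals `(a + 1) ^ 2`.
  obtain ⟨r₁, r₂, r₃, r₄, b₁, b₂, b₃, b₄, b₅, b₆, b₇, b₈, -, b₉⟩ := exists_roots hy1 hy hx hz
    (charPoly_neg_one_nonneg a h) hy0 hw0 hx0 hz0
  exact ⟨r₁, r₂, r₃, r₄, b₂.trans b₃, b₄.trans b₅, b₆.trans b₇, hy1.trans b₃, b₉⟩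

theorem quartic_nonneg_of_mem {r₁ r₂ r₃ r₄ : ℝ} (h₁₂ : r₁ < r₂) (h₃₄ : r₃ < r₄)
    {x : ℝ} (hx : x ∈ Set.Icc r₂ r₃) : 0 ≤ quartic r₁ r₂ r₃ r₄ x := by
  obtain ⟨h1, h2⟩ := hx
  rw [show quartic r₁ r₂ r₃ r₄ x = (x - r₁) * (x - r₂) * ((r₃ - x) * (r₄ - x)) by
    rw [quartic]; ring]
  exact mul_nonneg (mul_nonneg (by linarith) (by linarith))
    (mul_nonneg (by linarith) (by linarith))

theorem fst_mem (hC : IsClosedComponent a h C) (ha : -2 < a) {r₁ r₂ r₃ r₄ : ℝ} (h₁₂ : r₁ < r₂)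
    (h₂₃ : r₂ < r₃) (h₃₄ : r₃ < r₄) (hP : ∀ x, charPoly a h x = quartic r₁ r₂ r₃ r₄ x)
    {v : ℝ × ℝ} (hv : v ∈ C) : v.1 ∈ Set.Icc r₂ r₃ := by
  obtain ⟨w, hw, hne, hw0⟩ := hC.exists_charPoly_pos
  have hw1 : -1 < w.1 := (not_lt.1 (hC.not_lt_neg_one ha hw hw0)).lt_of_ne hne.symm
  obtain ⟨x, hx, hx0⟩ := hC.exists_neg_right hw hw1
  obtain ⟨y, hy1, hy, hy0⟩ := hC.exists_neg_between hw hw1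
  have hproj := hC.isPreconnected.image Prod.fst continuous_fst.continuousOn
  have hnot {t : ℝ} (ht : charPoly a h t < 0) : t ∉ Prod.fst '' C := by
    rintro ⟨m, hm, rfl⟩
    exact absurd (hC.charPoly_nonneg hm) (not_le.2 ht)
  have hvx : v.1 < x := by
    by_contra hc
    exact hnot hx0 (hproj.Icc_subset ⟨w, hw, rfl⟩ ⟨v, hv, rfl⟩ ⟨hx.le, not_lt.1 hc⟩)
  have hyv : y < v.1 := by
    by_contra hc
    exact hnot hy0 (hproj.Icc_subset ⟨v, hv, rfl⟩ ⟨w, hw, rfl⟩ ⟨not_lt.1 hc, hy.le⟩)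
  have hv0 := hC.charPoly_nonneg hv
  rw [hP] at hx0 hy0 hw0 hv0
  have hsign (t : ℝ) : quartic r₁ r₂ r₃ r₄ t = (t - r₁) * (t - r₂) * ((t - r₃) * (t - r₄)) := by
    rw [quartic]; ring
  have hneg {t : ℝ} (ht : quartic r₁ r₂ r₃ r₄ t < 0) :
      (r₁ < t ∧ t < r₂) ∨ (r₃ < t ∧ t < r₄) := by
    by_contra! hc
    refine absurd ht (not_lt.2 ?_)
    rw [hsign]
    rcases le_or_gt t r₁ with g1 | g1
    · exact mul_nonneg (mul_nonneg_of_nonpos_of_nonpos (by linarith) (by linarith))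
        (mul_nonneg_of_nonpos_of_nonpos (by linarith) (by linarith))
    have g2 := hc.1 g1
    rcases le_or_gt t r₃ with g3 | g3
    · exact mul_nonneg (mul_nonneg (by linarith) (by linarith))
        (mul_nonneg_of_nonpos_of_nonpos (by linarith) (by linarith))
    have g4 := hc.2 g3
    exact mul_nonneg (mul_nonneg (by linarith) (by linarith))
      (mul_nonneg (by linarith) (by linarith))
  have hleft {t : ℝ} (h1 : r₁ < t) (h2 : t < r₂) : quartic r₁ r₂ r₃ r₄ t < 0 := by
    rw [hsign]
    exact mul_neg_of_neg_of_pos (mul_neg_of_pos_of_neg (by linarith) (by linarith))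
      (mul_pos_of_neg_of_neg (by linarith) (by linarith))
  have hright {t : ℝ} (h1 : r₃ < t) (h2 : t < r₄) : quartic r₁ r₂ r₃ r₄ t < 0 := by
    rw [hsign]
    exact mul_neg_of_pos_of_neg (mul_pos (by linarith) (by linarith))
      (mul_neg_of_pos_of_neg (by linarith) (by linarith))
  rcases hneg hy0 with ⟨y1, y2⟩ | ⟨y1, y2⟩
  · rcases hneg hx0 with ⟨x1, x2⟩ | ⟨x1, x2⟩
    · exact absurd (hleft (t := w.1) (by linarith) (by linarith)) (by linarith)
    · constructor
      · by_contra hc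
        exact absurd (hleft (t := v.1) (by linarith) (by linarith)) (by linarith)
      · by_contra hc
        exact absurd (hright (t := v.1) (by linarith) (by linarith)) (by linarith)
  · rcases hneg hx0 with ⟨x1, x2⟩ | ⟨x1, x2⟩
    · linarith
    · exact absurd (hright (t := w.1) (by linarith) (by linarith)) (by linarith)

theorem swap (hC : IsClosedComponent a h C) : IsClosedComponent a h (Prod.swap '' C) where
  subset_level := by
    rintro _ ⟨w, hw, rfl⟩
    rw [invariant_swap, hC.subset_level w hw]
  isPreconnected := hC.isPreconnected.image _ continuous_swap.continuousOn
  isCompact := hC.isCompact.image continuous_swap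
  nontrivial := hC.nontrivial.image Prod.swap_injective
  maximal := by
    rintro S hS hlev ⟨w, hwS, v, hv, rfl⟩
    have := hC.maximal (Prod.swap '' S) (hS.image _ continuous_swap.continuousOn)
      (by rintro _ ⟨x, hx, rfl⟩; rw [invariant_swap, hlev x hx])
      ⟨v, ⟨v.swap, hwS, v.swap_swap⟩, hv⟩
    intro x hx
    exact ⟨x.swap, this ⟨x, hx, rfl⟩, x.swap_swap⟩

/-- The reflected set is again a closed component of the same level, so the bound on first
coordinates applies to it; the component need not be known to be symmetric. -/
theorem snd_mem (hC : IsClosedComponent a h C) (ha : -2 < a) {r₁ r₂ r₃ r₄ : ℝ} (h₁₂ : r₁ < r₂)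
    (h₂₃ : r₂ < r₃) (h₃₄ : r₃ < r₄) (hP : ∀ x, charPoly a h x = quartic r₁ r₂ r₃ r₄ x)
    {v : ℝ × ℝ} (hv : v ∈ C) : v.2 ∈ Set.Icc r₂ r₃ :=
  hC.swap.fst_mem ha h₁₂ h₂₃ h₃₄ hP ⟨v, hv, rfl⟩

/-- The part of the level set over the interval between the middle roots is symmetric. -/
theorem snd_mem_of_level (hC : IsClosedComponent a h C) (ha : -2 < a) {r₁ r₂ r₃ r₄ : ℝ}
    (h₁₂ : r₁ < r₂) (h₂₃ : r₂ < r₃) (h₃₄ : r₃ < r₄) (hr : -1 < r₂)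
    (hP : ∀ x, charPoly a h x = quartic r₁ r₂ r₃ r₄ x) {v : ℝ × ℝ} (hv : invariant a v = h)
    (hv1 : v.1 ∈ Set.Icc r₂ r₃) : v.2 ∈ Set.Icc r₂ r₃ := by
  obtain ⟨w, hw⟩ := hC.nontrivial.nonempty
  refine hC.snd_mem ha h₁₂ h₂₃ h₃₄ hP (hC.mem_of_level (r := r₂) isPreconnected_Icc
    (by simp [hr]) (fun q hq => ?_) ⟨le_rfl, h₂₃.le⟩ (by simp [hP, quartic]) hw
    (hC.fst_mem ha h₁₂ h₂₃ h₃₄ hP hw) hv hv1)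
  rw [hP]
  exact quartic_nonneg_of_mem h₁₂ h₃₄ hq

end IsClosedComponent

/-! ### The trajectory and the map -/

/-- The momentum at position `q` and velocity `v`. -/
def momentum (a q v : ℝ) : ℝ := (v - (q ^ 2 - a * q)) / (2 * (q + 1))

/-- The rate of change of the momentum at `(q, p)`. -/
def momentumVel (a q p : ℝ) : ℝ := -(p ^ 2 - a * p + 2 * q + 2 * p * q)

theorem momentum_eq {a q v : ℝ} (hq : -1 < q) :
    2 * (q + 1) * momentum a q v + (q ^ 2 - a * q) = v := by
  have : q + 1 ≠ 0 := by linarith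
  rw [momentum]
  field_simp
  ring

theorem momentum_add_momentum_neg {a q v : ℝ} (hq : -1 < q) :
    momentum a q v + momentum a q (-v) = force a q := by
  have : q + 1 ≠ 0 := by linarith
  rw [momentum, momentum, force]
  field_simp
  ring

theorem momentum_zero (a q : ℝ) : momentum a q 0 = force a q / 2 := by
  rw [momentum, force, mul_comm (2 : ℝ), ← div_div]
  ring

theorem invariant_momentum {a h q v : ℝ} (hq : -1 < q) (hv : v ^ 2 = charPoly a h q) :
    invariant a (q, momentum a q v) = h := by
  have h1 := charPoly_eq_sq a (q, momentum a q v)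
  simp only [momentum_eq hq, hv] at h1
  have h4 : 4 * (q + 1) * (invariant a (q, momentum a q v) - h) = 0 := by
    rw [charPoly, charPoly] at h1
    linear_combination h1
  have := (mul_eq_zero.1 h4).resolve_left (by linarith)
  linarith

theorem quarticDeriv_eq {a h r₁ r₂ r₃ r₄ : ℝ}
    (hP : ∀ x, charPoly a h x = quartic r₁ r₂ r₃ r₄ x) (x : ℝ) :
    quarticDeriv r₁ r₂ r₃ r₄ x =
      4 * x ^ 3 - 6 * (2 + a) * x ^ 2 + 2 * (a ^ 2 - 4) * x + 4 * h := by
  have h1 := hasDerivAt_quartic r₁ r₂ r₃ r₄ x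
  rw [← funext hP] at h1
  refine h1.unique (((((hasDerivAt_pow 4 x).sub ((hasDerivAt_pow 3 x).const_mul
    (2 * (2 + a)))).add ((hasDerivAt_pow 2 x).const_mul (a ^ 2 - 4))).add
    ((hasDerivAt_id x).const_mul (4 * h))).add_const (4 * h) |>.congr_deriv ?_)
  push_cast
  ring

/-- By the symmetry of `H`, the momentum obeys the same energy relation as the position. -/
theorem momentumVel_sq {a h q p : ℝ} (hp : invariant a (q, p) = h) :
    momentumVel a q p ^ 2 = charPoly a h p := by
  have := charPoly_eq_sq a (p, q)
  rw [show (p, q) = (q, p).swap from rfl, invariant_swap, hp] at this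
  simp only [Prod.fst_swap, Prod.snd_swap] at this
  rw [this, momentumVel]
  ring

/-- The oscillation with given energy between two roots is unique. -/
theorem oscillation_unique {r₁ r₂ r₃ r₄ : ℝ} {u v u' v' : ℝ → ℝ}
    (hu : ∀ t, HasDerivAt u (u' t) t)
    (hu' : ∀ t, HasDerivAt u' (quarticDeriv r₁ r₂ r₃ r₄ (u t) / 2) t)
    (hv : ∀ t, HasDerivAt v (v' t) t)
    (hv' : ∀ t, HasDerivAt v' (quarticDeriv r₁ r₂ r₃ r₄ (v t) / 2) t)
    (bu : ∀ t, u t ∈ Set.Icc r₂ r₃) (bv : ∀ t, v t ∈ Set.Icc r₂ r₃)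
    (eu : ∀ t, u' t ^ 2 = quartic r₁ r₂ r₃ r₄ (u t))
    (ev : ∀ t, v' t ^ 2 = quartic r₁ r₂ r₃ r₄ (v t))
    (h0 : u 0 = v 0) (h0' : u' 0 = v' 0) : u = v := by
  have hc : Continuous (quartic r₁ r₂ r₃ r₄) :=
    continuous_iff_continuousAt.2 fun x => (hasDerivAt_quartic r₁ r₂ r₃ r₄ x).continuousAt
  obtain ⟨B, hB⟩ := isCompact_Icc.exists_bound_of_continuousOn
    (hc.continuousOn (s := Set.Icc r₂ r₃))
  have key {x y : ℝ} (hx : x ∈ Set.Icc r₂ r₃) (hy : y ^ 2 = quartic r₁ r₂ r₃ r₄ x) :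
      y ∈ Set.Icc (-√B) (√B) := by
    rw [Set.mem_Icc, ← abs_le]
    exact Real.abs_le_sqrt (hy ▸ (le_abs_self _).trans (hB x hx))
  refine eq_of_hasDerivAt_of_hasDerivAt (g := fun x => quarticDeriv r₁ r₂ r₃ r₄ x / 2) ?_
    hu hu' hv hv' bu bv (fun t => key (bu t) (eu t)) (fun t => key (bv t) (ev t)) h0 h0'
  unfold quarticDeriv
  fun_prop

section

variable {a h r₁ r₂ r₃ r₄ : ℝ}

theorem wave_mem_Icc (h₁₂ : r₁ < r₂) (h₂₃ : r₂ < r₃) (h₃₄ : r₃ < r₄) (t : ℝ) :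
    wave r₁ r₂ r₃ r₄ t ∈ Set.Icc r₂ r₃ := by
  have := IsChain.wave_mem (Or.inl ⟨h₁₂, h₂₃, h₃₄⟩ : IsChain r₁ r₂ r₃ r₄) t
  constructor <;> by_contra hc <;> push Not at hc <;> nlinarith

/-- This is Hamilton's second equation; it follows from `q̈ = P'(q) / 2` once the velocity and the
level are written in terms of `q` and `p`. -/
theorem hasDerivAt_momentum (h₁₂ : r₁ < r₂) (h₂₃ : r₂ < r₃) (h₃₄ : r₃ < r₄) (hr : -1 < r₂)
    (hP : ∀ x, charPoly a h x = quartic r₁ r₂ r₃ r₄ x) (t : ℝ) :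
    HasDerivAt (fun t => momentum a (wave r₁ r₂ r₃ r₄ t) (waveVel r₁ r₂ r₃ r₄ t))
      (momentumVel a (wave r₁ r₂ r₃ r₄ t)
        (momentum a (wave r₁ r₂ r₃ r₄ t) (waveVel r₁ r₂ r₃ r₄ t))) t := by
  have hch : IsChain r₁ r₂ r₃ r₄ := Or.inl ⟨h₁₂, h₂₃, h₃₄⟩
  have hq : -1 < wave r₁ r₂ r₃ r₄ t := hr.trans_le (wave_mem_Icc h₁₂ h₂₃ h₃₄ t).1
  have hE := hch.hasDerivAt_wave t
  have hq1 : 2 * (wave r₁ r₂ r₃ r₄ t + 1) ≠ 0 := by linarith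
  have hinv := invariant_momentum hq ((hch.waveVel_sq t).trans (hP _).symm)
  refine (((hch.hasDerivAt_waveVel t).sub ((hE.pow 2).sub (hE.const_mul a))).div
    ((hE.add_const 1).const_mul 2) hq1).congr_deriv ?_
  have hv := momentum_eq (a := a) (v := waveVel r₁ r₂ r₃ r₄ t) hq
  rw [quarticDeriv_eq hP, div_eq_iff (pow_ne_zero 2 hq1)]
  generalize momentum a (wave r₁ r₂ r₃ r₄ t) (waveVel r₁ r₂ r₃ r₄ t) = p at *
  simp only [Pi.sub_apply, Pi.pow_apply]
  rw [← hinv, ← hv, momentumVel, invariant]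
  push_cast
  ring

/-- The momentum along the oscillation is the oscillation advanced by the step time. -/
theorem momentum_wave (h₁₂ : r₁ < r₂) (h₂₃ : r₂ < r₃) (h₃₄ : r₃ < r₄) (hr : -1 < r₂)
    (hP : ∀ x, charPoly a h x = quartic r₁ r₂ r₃ r₄ x)
    (hsym : ∀ v : ℝ × ℝ, invariant a v = h → v.1 ∈ Set.Icc r₂ r₃ → v.2 ∈ Set.Icc r₂ r₃) (t : ℝ) :
    momentum a (wave r₁ r₂ r₃ r₄ t) (waveVel r₁ r₂ r₃ r₄ t) =
      wave r₁ r₂ r₃ r₄ (t + crossTime r₁ r₂ r₃ r₄ (force a r₂ / 2)) := by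
  have hch : IsChain r₁ r₂ r₃ r₄ := Or.inl ⟨h₁₂, h₂₃, h₃₄⟩
  set τ := crossTime r₁ r₂ r₃ r₄ (force a r₂ / 2)
  have hmem := wave_mem_Icc h₁₂ h₂₃ h₃₄
  have hq (t : ℝ) : -1 < wave r₁ r₂ r₃ r₄ t := hr.trans_le (hmem t).1
  have hinv (t : ℝ) := invariant_momentum (hq t) ((hch.waveVel_sq t).trans (hP _).symm)
  have hp := hasDerivAt_momentum h₁₂ h₂₃ h₃₄ hr hP
  have hbp (t : ℝ) := hsym _ (hinv t) (hmem t)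
  have hsq (t : ℝ) := (momentumVel_sq (hinv t)).trans (hP _)
  have hv0 : waveVel r₁ r₂ r₃ r₄ 0 = 0 := by
    have := hch.waveVel_neg 0
    rw [neg_zero] at this
    linarith
  have hβ : momentum a (wave r₁ r₂ r₃ r₄ 0) (waveVel r₁ r₂ r₃ r₄ 0) = force a r₂ / 2 := by
    rw [hch.wave_zero, hv0, momentum_zero]
  have hβτ : wave r₁ r₂ r₃ r₄ τ = force a r₂ / 2 := by
    have := hbp 0
    simp only [hβ] at this
    exact hch.wave_crossTime (by nlinarith [this.1, this.2])
  have hvel : momentumVel a r₂ (force a r₂ / 2) = waveVel r₁ r₂ r₃ r₄ τ := by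
    have h1 := hsq 0
    rw [hβ, hch.wave_zero, ← hβτ, ← hch.waveVel_sq, hβτ] at h1
    -- The squared velocities agree, so only signs matter: `4 (r₂ + 1) ṗ = P'(r₂) > 0` at the start,
    -- and `wave` is not descending at its first passage.
    refine (pow_left_inj₀ ?_ ?_ two_ne_zero).1 h1
    · have h2 := hinv 0
      rw [hβ, hch.wave_zero] at h2
      have h3 := momentum_eq (a := a) (v := 0) hr
      rw [momentum_zero] at h3
      have h4 := quarticDeriv_eq hP r₂
      have h5 : quarticDeriv r₁ r₂ r₃ r₄ r₂ = (r₂ - r₁) * ((r₂ - r₃) * (r₂ - r₄)) := by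
        rw [quarticDeriv]; ring
      have h6 : 0 < (r₂ - r₁) * ((r₂ - r₃) * (r₂ - r₄)) :=
        mul_pos (by linarith) (mul_pos_of_neg_of_neg (by linarith) (by linarith))
      have h7 : 4 * (r₂ + 1) * momentumVel a r₂ (force a r₂ / 2) =
          (r₂ - r₁) * ((r₂ - r₃) * (r₂ - r₄)) := by
        rw [← h5, h4, ← h2, momentumVel, invariant]
        simp only
        generalize force a r₂ / 2 = p at *
        linear_combination (-4 * r₂ + 2 * a - 4 * p) * h3
      by_contra hc
      have : 4 * (r₂ + 1) * momentumVel a r₂ (force a r₂ / 2) ≤ 0 :=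
        mul_nonpos_of_nonneg_of_nonpos (by linarith) (not_le.1 hc).le
      linarith
    · exact nonneg_of_mul_nonneg_right (hch.mul_waveVel_crossTime _) (sub_pos.2 h₁₂)
  refine congrFun (oscillation_unique (r₁ := r₁) (r₂ := r₂) (r₃ := r₃) (r₄ := r₄) hp (fun t => ?_)
    (fun t => (hch.hasDerivAt_wave (t + τ)).comp_add_const t τ)
    (fun t => (hch.hasDerivAt_waveVel (t + τ)).comp_add_const t τ)
    hbp (fun t => hmem _) hsq (fun t => hch.waveVel_sq _) ?_ ?_) t
  · have hE := hch.hasDerivAt_wave t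
    have hpt := hp t
    have hv := momentum_eq (a := a) (v := waveVel r₁ r₂ r₃ r₄ t) (hq t)
    have h2 := hinv t
    unfold momentumVel at hpt ⊢
    refine ((((hpt.pow 2).sub (hpt.const_mul a)).add (hE.const_mul 2)).add
      ((hpt.const_mul 2).mul hE)).neg.congr_deriv ?_
    rw [quarticDeriv_eq hP]
    generalize momentum a (wave r₁ r₂ r₃ r₄ t) (waveVel r₁ r₂ r₃ r₄ t) = p at *
    rw [← h2, ← hv, invariant]
    push_cast
    ring
  · simp only [hβ, zero_add, hβτ]
  · simp only [hch.wave_zero, hv0, momentum_zero, zero_add, hvel]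

/-- The three-term recurrence of the oscillation sampled at the step time. -/
theorem wave_add_wave (h₁₂ : r₁ < r₂) (h₂₃ : r₂ < r₃) (h₃₄ : r₃ < r₄) (hr : -1 < r₂)
    (hP : ∀ x, charPoly a h x = quartic r₁ r₂ r₃ r₄ x)
    (hsym : ∀ v : ℝ × ℝ, invariant a v = h → v.1 ∈ Set.Icc r₂ r₃ → v.2 ∈ Set.Icc r₂ r₃) (t : ℝ) :
    wave r₁ r₂ r₃ r₄ (t + crossTime r₁ r₂ r₃ r₄ (force a r₂ / 2)) +
      wave r₁ r₂ r₃ r₄ (t - crossTime r₁ r₂ r₃ r₄ (force a r₂ / 2)) =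
      force a (wave r₁ r₂ r₃ r₄ t) := by
  have hch : IsChain r₁ r₂ r₃ r₄ := Or.inl ⟨h₁₂, h₂₃, h₃₄⟩
  have h1 := momentum_wave h₁₂ h₂₃ h₃₄ hr hP hsym t
  -- Reversing time keeps the position and flips the velocity, giving the other root of the
  -- quadratic in `p`.
  have h2 := momentum_wave h₁₂ h₂₃ h₃₄ hr hP hsym (-t)
  rw [hch.wave_neg, hch.waveVel_neg, ← hch.wave_neg (-t + _), neg_add, neg_neg,
    ← sub_eq_add_neg] at h2
  rw [← h1, ← h2]
  exact momentum_add_momentum_neg (hr.trans_le (wave_mem_Icc h₁₂ h₂₃ h₃₄ t).1)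

/-! ### The closed forms as translated oscillations, and the choice of phase. -/

theorem param₁_eq_wave (σ q₀ t : ℝ) : param₁ σ q₀ r₁ r₂ r₃ r₄ t =
    wave r₁ r₂ r₃ r₄ (t + σ * crossTime r₁ r₂ r₃ r₄ q₀) := by
  have : phaseShift₁ σ q₀ r₁ r₂ r₃ r₄ = -σ * crossTime r₁ r₂ r₃ r₄ q₀ := rfl
  rw [← sub_neg_eq_add, ← neg_mul, ← this]
  rfl

/-- Reversing the roots preserves modulus and frequency and changes only the ratio. The phase
changes sign because this oscillation starts at `r₃` and descends. -/
theorem param₂_eq_wave (σ q₀ t : ℝ) : param₂ σ q₀ r₁ r₂ r₃ r₄ t =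
    wave r₄ r₃ r₂ r₁ (t + -σ * crossTime r₄ r₃ r₂ r₁ q₀) := by
  have hm : modulus r₄ r₃ r₂ r₁ = modulus r₁ r₂ r₃ r₄ := by
    rw [modulus, modulus]
    congr 2 <;> ring
  have hf : frequency r₄ r₃ r₂ r₁ = √((r₄ - r₂) * (r₃ - r₁)) := by
    rw [frequency]
    congr 1
    ring
  have hk : ratio r₄ r₃ r₂ = (r₃ - r₂) / (r₄ - r₂) := by
    rw [ratio, ← neg_sub r₃ r₂, ← neg_sub r₄ r₂, neg_div_neg_eq]
  have hs : phaseShift₂ σ q₀ r₁ r₂ r₃ r₄ = σ * crossTime r₄ r₃ r₂ r₁ q₀ := by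
    rw [phaseShift₂, crossTime, hm, hf, ← neg_sub r₄ r₂, ← neg_sub r₃ r₂, neg_mul, neg_mul,
      neg_div_neg_eq]
  rw [neg_mul, ← sub_eq_add_neg, ← hs, param₂, wave, profile, hk, amplitude, hm, hf]
  rfl

/-- The oscillation is even and its velocity odd, so the times `±crossTime` are passages through the
same point with opposite velocities. -/
theorem IsChain.wave_sign_mul_crossTime (hch : IsChain r₁ r₂ r₃ r₄) {σ x : ℝ}
    (hσ : σ = 1 ∨ σ = -1) (hx : (x - r₂) * (x - r₃) ≤ 0) :
    wave r₁ r₂ r₃ r₄ (σ * crossTime r₁ r₂ r₃ r₄ x) = x ∧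
      0 ≤ (r₂ - r₁) * (σ * waveVel r₁ r₂ r₃ r₄ (σ * crossTime r₁ r₂ r₃ r₄ x)) := by
  have h1 := hch.wave_crossTime hx
  have h2 := hch.mul_waveVel_crossTime x
  rcases hσ with rfl | rfl
  · simpa [h1] using h2
  · simpa [h1, hch.wave_neg, hch.waveVel_neg] using h2

/-- The velocity at the starting time is determined by its square and its sign. -/
theorem eq_of_sq_eq_of_sign {σ x y : ℝ} (hσ : σ = 1 ∨ σ = -1) (hxy : x ^ 2 = y ^ 2)
    (hx : 0 ≤ σ * x) (hy : 0 ≤ σ * y) : x = y := by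
  have hne : σ ≠ 0 := by rcases hσ with rfl | rfl <;> norm_num
  refine mul_left_cancel₀ hne ((pow_left_inj₀ hx hy two_ne_zero).1 ?_)
  rw [mul_pow, mul_pow, hxy]

theorem branchSign_mul_nonneg {z : ℝ × ℝ} (hz : -1 < z.1) :
    0 ≤ branchSign a z * (2 * (z.1 + 1) * z.2 + (z.1 ^ 2 - a * z.1)) := by
  have h1 : 2 * (z.1 + 1) * (force a z.1 / 2) + (z.1 ^ 2 - a * z.1) = 0 := by
    rw [← momentum_zero]
    exact momentum_eq hz
  have h2 : 2 * (z.1 + 1) * z.2 + (z.1 ^ 2 - a * z.1) =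
      2 * (z.1 + 1) * (z.2 - force a z.1 / 2) := by linear_combination h1
  rw [h2, branchSign]
  split_ifs with h
  · rw [one_mul]
    exact mul_nonneg (by linarith) (by linarith)
  · rw [← mul_neg_one, mul_comm, mul_assoc]
    exact mul_nonneg (by linarith) (by linarith)

theorem branchSign_eq (a : ℝ) (z : ℝ × ℝ) : branchSign a z = 1 ∨ branchSign a z = -1 := by
  rw [branchSign]
  split_ifs <;> simp

end

end

end McMillan

theorem mainTheorem3 (a : ℝ) (ha : -2 < a) (ha' : a < 2) (z₀ : ℝ × ℝ)
    (hz₀ : McMillan.OnClosedInvariantCurve a z₀) :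
    ∃ r₁ r₂ r₃ r₄ : ℝ,
      r₁ < r₂ ∧ r₂ < r₃ ∧ r₃ < r₄ ∧
      (∀ x : ℝ, McMillan.charPoly a (McMillan.invariant a z₀) x =
        (x - r₁) * (x - r₂) * (x - r₃) * (x - r₄)) ∧
      (∀ n : ℕ, ((McMillan.sextupoleMap a)^[n] z₀).1 ∈ Set.Icc r₂ r₃) ∧
      -- the integral that defines the step time converges
      IntervalIntegrable
        (fun x : ℝ => 1 / √(McMillan.charPoly a (McMillan.invariant a z₀) x))
        MeasureTheory.volume r₂ (McMillan.force a r₂ / 2) ∧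
      -- the two forms of `q(t)` agree at all times
      (∀ t : ℝ, McMillan.param₁ (McMillan.branchSign a z₀) z₀.1 r₁ r₂ r₃ r₄ t =
        McMillan.param₂ (McMillan.branchSign a z₀) z₀.1 r₁ r₂ r₃ r₄ t) ∧
      -- `q(t)` is the coordinate of the Hamiltonian trajectory that starts at `z₀`
      (McMillan.param₁ (McMillan.branchSign a z₀) z₀.1 r₁ r₂ r₃ r₄ 0 = z₀.1 ∧
        ∃ p : ℝ → ℝ, p 0 = z₀.2 ∧
          McMillan.SolvesHamilton a
            (McMillan.param₁ (McMillan.branchSign a z₀) z₀.1 r₁ r₂ r₃ r₄) p) ∧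
      -- the orbit of the map: `q_n = q(n T')` and `p_n = q((n + 1) T')`
      (∀ n : ℕ,
        ((McMillan.sextupoleMap a)^[n] z₀).1 =
          McMillan.param₁ (McMillan.branchSign a z₀) z₀.1 r₁ r₂ r₃ r₄
            (n * McMillan.stepTime a (McMillan.invariant a z₀) r₂) ∧
        ((McMillan.sextupoleMap a)^[n] z₀).2 =
          McMillan.param₁ (McMillan.branchSign a z₀) z₀.1 r₁ r₂ r₃ r₄
            ((n + 1) * McMillan.stepTime a (McMillan.invariant a z₀) r₂)) := by
  have hC := hz₀.isClosedComponent
  have hz : z₀ ∈ connectedComponentIn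
      {w : ℝ × ℝ | McMillan.invariant a w = McMillan.invariant a z₀} z₀ :=
    mem_connectedComponentIn rfl
  obtain ⟨r₁, r₂, r₃, r₄, h₁₂, h₂₃, h₃₄, hr, hP⟩ := hC.exists_roots_of_component ha ha'
  have hsym := fun v => hC.snd_mem_of_level ha h₁₂ h₂₃ h₃₄ hr hP (v := v)
  have hq₀ := hC.fst_mem ha h₁₂ h₂₃ h₃₄ hP hz
  set h := McMillan.invariant a z₀ with hh
  have hch : McMillan.IsChain r₁ r₂ r₃ r₄ := Or.inl ⟨h₁₂, h₂₃, h₃₄⟩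
  have hch' : McMillan.IsChain r₄ r₃ r₂ r₁ := Or.inr ⟨h₁₂, h₂₃, h₃₄⟩
  have hmem := McMillan.wave_mem_Icc h₁₂ h₂₃ h₃₄
  have hσ := McMillan.branchSign_eq a z₀
  have hq1 : -1 < z₀.1 := hr.trans_le hq₀.1
  have hD := McMillan.branchSign_mul_nonneg (a := a) hq1
  set σ := McMillan.branchSign a z₀
  obtain ⟨hs0, hs1⟩ := hch.wave_sign_mul_crossTime (x := z₀.1) hσ
    (by nlinarith [hq₀.1, hq₀.2])
  set s := σ * McMillan.crossTime r₁ r₂ r₃ r₄ z₀.1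
  have hDsq : McMillan.quartic r₁ r₂ r₃ r₄ z₀.1 =
      (2 * (z₀.1 + 1) * z₀.2 + (z₀.1 ^ 2 - a * z₀.1)) ^ 2 := by
    rw [← hP, hh, McMillan.charPoly_eq_sq]
  -- The energy relation fixes the initial velocity up to sign, and the branch sign settles it.
  have hV : McMillan.waveVel r₁ r₂ r₃ r₄ s = 2 * (z₀.1 + 1) * z₀.2 + (z₀.1 ^ 2 - a * z₀.1) :=
    McMillan.eq_of_sq_eq_of_sign hσ (by rw [hch.waveVel_sq, hs0, hDsq])
      (nonneg_of_mul_nonneg_right hs1 (sub_pos.2 h₁₂)) hD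
  have hp₀ : McMillan.momentum a (McMillan.wave r₁ r₂ r₃ r₄ s)
      (McMillan.waveVel r₁ r₂ r₃ r₄ s) = z₀.2 := by
    have h1 : 2 * (z₀.1 + 1) ≠ 0 := by linarith
    rw [hs0, hV, McMillan.momentum, add_sub_cancel_right, mul_div_cancel_left₀ _ h1]
  have hpw := McMillan.momentum_wave h₁₂ h₂₃ h₃₄ hr hP hsym
  have hrec := McMillan.wave_add_wave h₁₂ h₂₃ h₃₄ hr hP hsym
  have hβ : McMillan.force a r₂ / 2 ∈ Set.Icc r₂ r₃ := by
    rw [← McMillan.momentum_zero]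
    refine hsym (r₂, _) (McMillan.invariant_momentum hr ?_) ⟨le_rfl, h₂₃.le⟩
    simp [hP, McMillan.quartic]
  obtain ⟨hint, hstep⟩ := McMillan.integral_inv_sqrt_quartic h₁₂ h₂₃ h₃₄ hβ.1 hβ.2
  have hT : McMillan.stepTime a h r₂ =
      McMillan.crossTime r₁ r₂ r₃ r₄ (McMillan.force a r₂ / 2) := by
    simp only [McMillan.stepTime, hP, hstep]
  rw [← hT] at hpw hrec
  set T := McMillan.stepTime a h r₂
  have horbit : ∀ n : ℕ, (McMillan.sextupoleMap a)^[n] z₀ =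
      (McMillan.wave r₁ r₂ r₃ r₄ (n * T + s), McMillan.wave r₁ r₂ r₃ r₄ ((n + 1) * T + s)) := by
    intro n
    induction n with
    | zero =>
      refine Prod.ext (by simpa using hs0.symm) ?_
      have := hpw s
      rw [hp₀, add_comm] at this
      simpa using this
    | succ n ih =>
      have h1 := hrec ((n + 1) * T + s)
      rw [Function.iterate_succ_apply', ih, McMillan.sextupoleMap]
      refine Prod.ext (by push_cast; rfl) ?_
      push_cast
      rw [← h1]
      ring_nf
  refine ⟨r₁, r₂, r₃, r₄, h₁₂, h₂₃, h₃₄, hP, fun n => ?_, ?_, fun t => ?_, ⟨?_, ?_⟩, fun n => ?_⟩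
  · rw [horbit]
    exact hmem _
  · simpa only [hP] using hint
  · rw [McMillan.param₁_eq_wave, McMillan.param₂_eq_wave]
    have hσ' : -σ = 1 ∨ -σ = -1 := by rcases hσ with e | e <;> simp [e]
    obtain ⟨hs0', hs1'⟩ := hch'.wave_sign_mul_crossTime (x := z₀.1) hσ'
      (by nlinarith [hq₀.1, hq₀.2])
    have hquartic : McMillan.quartic r₄ r₃ r₂ r₁ = McMillan.quartic r₁ r₂ r₃ r₄ := by
      funext x
      simp only [McMillan.quartic]
      ring
    have hquarticDeriv : McMillan.quarticDeriv r₄ r₃ r₂ r₁ = McMillan.quarticDeriv r₁ r₂ r₃ r₄ := by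
      funext x
      simp only [McMillan.quarticDeriv]
      ring
    have hV' : McMillan.waveVel r₄ r₃ r₂ r₁ (-σ * McMillan.crossTime r₄ r₃ r₂ r₁ z₀.1) =
        2 * (z₀.1 + 1) * z₀.2 + (z₀.1 ^ 2 - a * z₀.1) := by
      refine McMillan.eq_of_sq_eq_of_sign hσ (by rw [hch'.waveVel_sq, hs0', hquartic, hDsq]) ?_ hD
      -- The sign from `-σ` cancels the one from the reversed difference `r₃ - r₄`, so both closed
      -- forms start with the same velocity.
      exact nonneg_of_mul_nonneg_right (hs1'.trans_eq (by ring)) (sub_pos.2 h₃₄)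
    refine congrFun (McMillan.oscillation_unique (r₁ := r₁) (r₂ := r₂) (r₃ := r₃) (r₄ := r₄)
      (fun t => (hch.hasDerivAt_wave _).comp_add_const t s)
      (fun t => (hch.hasDerivAt_waveVel _).comp_add_const t s)
      (fun t => (hch'.hasDerivAt_wave _).comp_add_const t _)
      (fun t => hquarticDeriv ▸ (hch'.hasDerivAt_waveVel _).comp_add_const t _)
      (fun t => hmem _) (fun t => ?_) (fun t => hch.waveVel_sq _)
      (fun t => hquartic ▸ hch'.waveVel_sq _) ?_ ?_) t
    · have := hch'.wave_mem (t + -σ * McMillan.crossTime r₄ r₃ r₂ r₁ z₀.1)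
      constructor <;> by_contra hc <;> push Not at hc <;> nlinarith
    · rw [zero_add, zero_add, hs0, hs0']
    · rw [zero_add, zero_add, hV, hV']
  · rw [McMillan.param₁_eq_wave, zero_add]
    exact hs0
  · refine ⟨fun t => McMillan.momentum a (McMillan.wave r₁ r₂ r₃ r₄ (t + s))
      (McMillan.waveVel r₁ r₂ r₃ r₄ (t + s)), by simpa only [zero_add] using hp₀, fun t => ?_⟩
    rw [funext fun t => McMillan.param₁_eq_wave (r₁ := r₁) (r₂ := r₂) (r₃ := r₃) (r₄ := r₄) σ z₀.1 t]
    refine ⟨((hch.hasDerivAt_wave (t + s)).comp_add_const t s).congr_deriv ?_,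
      (McMillan.hasDerivAt_momentum h₁₂ h₂₃ h₃₄ hr hP (t + s)).comp_add_const t s⟩
    have := McMillan.momentum_eq (a := a) (v := McMillan.waveVel r₁ r₂ r₃ r₄ (t + s))
      (hr.trans_le (hmem (t + s)).1)
    linear_combination -this
  · rw [horbit, McMillan.param₁_eq_wave, McMillan.param₁_eq_wave]
    exact ⟨rfl, rfl⟩
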